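/- Let $r\ge 0$, let $e^0,\dots,e^{r+1}$ be a basis of a real vector space of dimension $r+2$, let $A_{r+1}=\{e^i-e^j : 0\le i,j\le r+1,\ i\ne j\}$, and let $V$ be the $(r+1)$-dimensional real vector space whose dual $V^*$ is $\{\sum_i a_ie^i : \sum_i a_i=0\}$, the span of $A_{r+1}$; concretely, $V=\{(x_0,\dots,x_{r+1}) : x_{r+1}=0\}$ with $e^i(x)=x_i$. Let $R$ be the ring of rational functions on $V$ generated over $\mathbb R$ by the linear forms on $V$ and the inverses $1/\alpha$, $\alpha\in A_{r+1}$. Let $S\subset R$ be the span of the functions $1/\prod_{\alpha\in\sigma}\alpha$, where $\sigma\subset A_{r+1}$ runs over the subsets that are bases of $V^*$, and let $\partial(V)R\subset R$ be the span of the directional derivatives $\partial(v)h$, $v\in V$, $h\in R$. Then $R=S\oplus\partial(V)R$, and the total residue $\mathrm{Tres}_{A_{r+1}}:R\to S$, defined as the projection along $\partial(V)R$, satisfies $$\mathrm{Tres}_{A_{r+1}}\left(\frac{(e^0-e^{r+1})^{r(r+1)/2}}{\prod_{0\le i<j\le r+1}(e^i-e^j)}\right) =\prod_{i=1}^{r-1}\frac{(2i)!}{i!\,(i+1)!}\;\sum_{w\in\Sigma_r}\epsilon(w)\,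 w\cdot\frac{1}{(e^0-e^1)(e^1-e^2)\cdots(e^r-e^{r+1})},$$ where $\Sigma_r$ is the group of permutations of $\{1,\dots,r\}$, acting by $w\cdot e^i=e^{w(i)}$ with $e^0$ and $e^{r+1}$ fixed, $\epsilon(w)$ is the sign of $w$, and an empty product is $1$. -/

import Mathlib

namespace TotalRes

noncomputable section

section General

variable {V : Type*} [AddCommGroup V] [Module ℝ V]

/-- The complement in `V` of the hyperplanes `α = 0`, `α ∈ Δ`. -/
def Reg (Δ : Set (Module.Dual ℝ V)) : Set V := {x | ∀ α ∈ Δ, α x ≠ 0}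

/-- The ring `R_Δ = Δ⁻¹ S(V*)` of rational functions with poles on the hyperplanes `α = 0`,
`α ∈ Δ`: the algebra of functions on `Reg Δ` generated by the linear forms on `V` and the inverses
of the elements of `Δ`. -/
def ratRing (Δ : Set (Module.Dual ℝ V)) : Subalgebra ℝ (Reg Δ → ℝ) :=
  Algebra.adjoin ℝ
    ({f | ∃ φ : Module.Dual ℝ V, f = fun x : Reg Δ => φ (x : V)} ∪
      {f | ∃ α ∈ Δ, f = fun x : Reg Δ => (α (x : V))⁻¹})

/-- `σ` is a basis of `Δ`: a subset of `Δ` whose elements form a basis of `V*`. -/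
def IsBasisOf (Δ : Set (Module.Dual ℝ V)) (σ : Finset (Module.Dual ℝ V)) : Prop :=
  (σ : Set (Module.Dual ℝ V)) ⊆ Δ ∧
    LinearIndependent ℝ (fun α : σ => (α : Module.Dual ℝ V)) ∧
    Submodule.span ℝ (σ : Set (Module.Dual ℝ V)) = ⊤

/-- The space `S_Δ` of simple elements: the span of the functions `f_σ = 1 / ∏_{α ∈ σ} α`,
`σ` a basis of `Δ`. -/
def simpleSpace (Δ : Set (Module.Dual ℝ V)) : Submodule ℝ (ratRing Δ) :=
  Submodule.span ℝ
    {f | ∃ σ, IsBasisOf Δ σ ∧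
      (f : Reg Δ → ℝ) = fun x : Reg Δ => 1 / ∏ α ∈ σ, α (x : V)}

/-- The derivative `(∂(v) f)(x) = d/dε f(x + ε v)` at `ε = 0` of a function on `Reg Δ`.
(`f` is extended by `0` outside `Reg Δ`, which does not matter for finite `Δ`, since then
`x + ε v` lies in `Reg Δ` for all small `ε`.) -/
def dirDeriv (Δ : Set (Module.Dual ℝ V)) (v : V) (f : Reg Δ → ℝ) : Reg Δ → ℝ :=
  fun x => lineDeriv ℝ (Function.extend Subtype.val f 0) (x : V) v

/-- The space `∂(V) R_Δ` spanned by the derivatives of elements of `R_Δ`. -/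
def derivSpace (Δ : Set (Module.Dual ℝ V)) : Submodule ℝ (ratRing Δ) :=
  Submodule.span ℝ
    {f | ∃ (v : V) (h : ratRing Δ), (f : Reg Δ → ℝ) = dirDeriv Δ v (h : Reg Δ → ℝ)}

open Classical in
/-- The total residue: the projection of `R_Δ` onto `S_Δ` along `∂(V) R_Δ`
(set to `0` if these subspaces should not be complementary). -/
def totalResidue (Δ : Set (Module.Dual ℝ V)) : ratRing Δ →ₗ[ℝ] simpleSpace Δ :=
  if h : IsCompl (simpleSpace Δ) (derivSpace Δ) then
    Submodule.projectionOnto (simpleSpace Δ) (derivSpace Δ) h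
  else 0

end General

/-- The vector space `V = {x_0 e_0 + ⋯ + x_{r+1} e_{r+1} : x_{r+1} = 0}`, with coordinates
`x_0, …, x_r`. -/
abbrev Space (r : ℕ) : Type := Fin (r + 1) → ℝ

/-- The restrictions to `V` of the coordinate forms `e^0, …, e^{r+1}`; so `e^i(x) = x_i` for
`i ≤ r` and `e^{r+1} = 0`. Restriction identifies
`{a_0 e^0 + ⋯ + a_{r+1} e^{r+1} : ∑ a_i = 0}`, the span of the roots, with `V*`. -/
def e (r : ℕ) : Fin (r + 2) → Module.Dual ℝ (Space r) :=
  Fin.snoc (α := fun _ => Module.Dual ℝ (Space r)) (fun i => LinearMap.proj i) 0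

/-- The root system `A_{r+1} = {e^i - e^j : 0 ≤ i, j ≤ r + 1, i ≠ j}`. -/
def rootsA (r : ℕ) : Set (Module.Dual ℝ (Space r)) := {α | ∃ i j, i ≠ j ∧ α = e r i - e r j}

lemma e_castSucc (r : ℕ) (i : Fin (r + 1)) (x : Space r) : e r i.castSucc x = x i := by
  simp [e]

lemma e_last (r : ℕ) (x : Space r) : e r (Fin.last (r + 1)) x = 0 := by
  simp [e]

lemma comp_mem_reg {r : ℕ} (w : Equiv.Perm (Fin (r + 1))) {x : Space r}
    (hx : x ∈ Reg (rootsA r)) : x ∘ w ∈ Reg (rootsA r) := by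
  have key : ∀ i j, i ≠ j → e r i x - e r j x ≠ 0 := fun i j hij =>
    hx _ ⟨i, j, hij, rfl⟩
  rintro α ⟨i, j, hij, rfl⟩
  rw [LinearMap.sub_apply]
  induction i using Fin.lastCases with
  | last =>
    induction j using Fin.lastCases with
    | last => exact absurd rfl hij
    | cast j =>
      have := key (Fin.last _) (w j).castSucc (Fin.castSucc_lt_last _).ne'
      simpa only [e_last, e_castSucc, Function.comp_apply] using this
  | cast i =>
    induction j using Fin.lastCases with
    | last =>
      have := key (w i).castSucc (Fin.last _) (Fin.castSucc_lt_last _).ne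
      simpa only [e_last, e_castSucc, Function.comp_apply] using this
    | cast j =>
      have := key (w i).castSucc (w j).castSucc (fun h => hij (by
        rw [w.injective (Fin.castSucc_injective _ h)]))
      simpa only [e_castSucc, Function.comp_apply] using this

/-- The action of a permutation `w` of `{0, …, r}` on functions on the complement of the root
hyperplanes, the one induced by `w · e^i = e^{w(i)}` (with `e^{r+1}` fixed). -/
def act {r : ℕ} (w : Equiv.Perm (Fin (r + 1))) (f : Reg (rootsA r) → ℝ) : Reg (rootsA r) → ℝ :=
  fun x => f ⟨(x : Space r) ∘ w, comp_mem_reg w x.2⟩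

/-- The function `(e^0 - e^{r+1})^{r(r+1)/2} / ∏_{0 ≤ i < j ≤ r+1} (e^i - e^j)`. -/
def morrisFun (r : ℕ) : Reg (rootsA r) → ℝ := fun x =>
  ((e r 0 - e r (Fin.last (r + 1))) (x : Space r)) ^ (r * (r + 1) / 2) /
    ∏ i : Fin (r + 2), ∏ j ∈ Finset.Ioi i, (e r i - e r j) (x : Space r)

lemma morrisFun_mem (r : ℕ) : morrisFun r ∈ ratRing (rootsA r) := by
  have h : morrisFun r =
      (fun x : Reg (rootsA r) => (e r 0 - e r (Fin.last (r + 1))) (x : Space r)) ^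
          (r * (r + 1) / 2) *
        ∏ i : Fin (r + 2), ∏ j ∈ Finset.Ioi i,
          (fun x : Reg (rootsA r) => ((e r i - e r j) (x : Space r))⁻¹) := by
    funext x
    simp [morrisFun, div_eq_mul_inv, Finset.prod_apply]
  rw [h]
  refine Subalgebra.mul_mem _ (Subalgebra.pow_mem _ ?_ _)
    (Subalgebra.prod_mem _ fun i _ => Subalgebra.prod_mem _ fun j hj => ?_)
  · exact Algebra.subset_adjoin (Set.mem_union_left _ ⟨_, rfl⟩)
  · exact Algebra.subset_adjoin
      (Set.mem_union_right _ ⟨_, ⟨i, j, (Finset.mem_Ioi.1 hj).ne, rfl⟩, rfl⟩)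

/-- The function `f_Π = 1 / ((e^0 - e^1)(e^1 - e^2) ⋯ (e^r - e^{r+1}))`. -/
def simpleRootFun (r : ℕ) : Reg (rootsA r) → ℝ := fun x =>
  1 / ∏ i : Fin (r + 1), (e r i.castSucc - e r i.succ) (x : Space r)

/-- The group `Σ_r` of permutations of `{1, …, r}`, as the permutations of `{0, …, r}` that
fix `0`. -/
def permsFixZero (r : ℕ) : Finset (Equiv.Perm (Fin (r + 1))) :=
  Finset.univ.filter fun w => w 0 = 0

end

end TotalRes

/-! Everything is done by induction on the rank, peeling off the variable `x_0`. Since `e^{r+1} = 0`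
on `V`, the root system is that of `n` coordinates `x_0, …, x_{n-1}` together with `x_n = 0`, and
forgetting `x_0` leads from rank `n + 1` to rank `n`.

Direct sum. An element of the ring has a partial fraction expansion in `x_0` with coefficients in
the ring of rank `n` (`mem_fracSpan`). Powers of `x_0` and poles of order at least two have
primitives in `x_0`, so only terms `c / (x_0 - x_j)` matter. Multiplying by `1 / (x_0 - x_j)` sends
simple elements to simple elements and derivatives to derivatives, which gives `ratRing_le_sup`.
Conversely, the residues in `x_0` of a simple element are simple (`invProd_mem_polarImage`) and
those of a derivative are derivatives (`derivSpan_le_polar`). As residues are unique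
(`eq_zero_of_polarMap_mem`), the intersection is zero (`simpleSpan_inf_derivSpan`).

Morris function. It suffices to find a simple element congruent to it modulo derivatives
(`totalResidue_eq`). Aomoto's method applies: with `z_i = x_0 - x_i`, summing the derivatives along
the middle variables of suitable functions relates the insertions of `e_{m+1}(z)` and `e_m(z)`
(`elemSymm_relation`). Iterating from `e_0` up to the last useful degree yields a Catalan number
(`aomotoFun_zero_sub_mem`), and there the insertion reduces the product of the `1 / z_i` to the sum
of the `1 / z_j` (`aomotoFun_top`). Modulo derivatives the numerator power of `x_0` over `z_j` may
be evaluated at `x_0 = x_j`, leaving the signed image under a transposition of the Morris function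
of lower rank. The coset decomposition of the symmetric group reassembles the alternating sum
(`morris_sub_mem`). -/

namespace TotalRes

noncomputable section

section

open Filter Topology

/-! ### Directional derivatives and function spaces for a general arrangement -/

section General

variable {V : Type*} [AddCommGroup V] [Module ℝ V] {Δ : Set (Module.Dual ℝ V)}

/-- The function on `Reg Δ` given by a linear form. -/
def linFun (Δ : Set (Module.Dual ℝ V)) (φ : Module.Dual ℝ V) : Reg Δ → ℝ := fun x => φ (x : V)

@[simp] lemma linFun_apply (φ : Module.Dual ℝ V) (x : Reg Δ) : linFun Δ φ x = φ (x : V) := rfl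

lemma linFun_mem (φ : Module.Dual ℝ V) : linFun Δ φ ∈ ratRing Δ :=
  Algebra.subset_adjoin (Or.inl ⟨φ, rfl⟩)

lemma linFun_inv_mem {α : Module.Dual ℝ V} (hα : α ∈ Δ) : (linFun Δ α)⁻¹ ∈ ratRing Δ :=
  Algebra.subset_adjoin (Or.inr ⟨α, hα, rfl⟩)

/-- `f` has derivative `f'` in the direction `v` at every point of `Reg Δ`. -/
def HasDir (v : V) (f f' : Reg Δ → ℝ) : Prop :=
  ∀ x : Reg Δ, HasDerivAt (fun t : ℝ => Function.extend Subtype.val f 0 ((x : V) + t • v)) (f' x) 0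

lemma HasDir.dirDeriv_eq {v : V} {f f' : Reg Δ → ℝ} (h : HasDir v f f') : dirDeriv Δ v f = f' :=
  funext fun x => (h x).deriv

lemma extend_coe (f : Reg Δ → ℝ) (x : Reg Δ) : Function.extend Subtype.val f 0 (x : V) = f x :=
  Subtype.val_injective.extend_apply f 0 x

lemma extend_of_mem (f : Reg Δ → ℝ) {x : V} (hx : x ∈ Reg Δ) :
    Function.extend Subtype.val f 0 x = f ⟨x, hx⟩ :=
  extend_coe f ⟨x, hx⟩

lemma extend_of_notMem (f : Reg Δ → ℝ) {x : V} (hx : x ∉ Reg Δ) :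
    Function.extend Subtype.val f 0 x = 0 :=
  Function.extend_apply' _ _ _ (by rintro ⟨y, rfl⟩; exact hx y.2)

/-- Each hyperplane is avoided for small `t`, and there are finitely many. Hence derivatives do not
see the extension by zero. The rules for sums, products and inverses hold without this, as both
sides vanish off `Reg Δ` (`0⁻¹ = 0`); constants and linear forms need it. -/
lemma eventually_mem_reg (hΔ : Δ.Finite) (x : Reg Δ) (v : V) :
    ∀ᶠ t : ℝ in 𝓝 0, (x : V) + t • v ∈ Reg Δ := by
  refine (eventually_all_finite hΔ).2 fun α hα => ?_
  have h : ContinuousAt (fun t : ℝ => α x + t * α v) 0 := by fun_prop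
  have := h.eventually_ne (y := 0) (by simpa using x.2 α hα)
  simpa using this

lemma HasDir.congr {v : V} {f f' g' : Reg Δ → ℝ} (h : HasDir v f f') (e : f' = g') :
    HasDir v f g' := e ▸ h

lemma HasDir.add {v : V} {f f' g g' : Reg Δ → ℝ} (hf : HasDir v f f') (hg : HasDir v g g') :
    HasDir v (f + g) (f' + g') := fun x => by
  convert! (hf x).add (hg x) using 2
  rename_i t
  by_cases h : (x : V) + t • v ∈ Reg Δ
  · simp [extend_of_mem _ h]
  · simp [extend_of_notMem _ h]

lemma HasDir.mul {v : V} {f f' g g' : Reg Δ → ℝ} (hf : HasDir v f f') (hg : HasDir v g g') :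
    HasDir v (f * g) (f' * g + f * g') := fun x => by
  have := (hf x).mul (hg x)
  simp only [zero_smul, add_zero, extend_coe] at this
  convert! this using 2
  rename_i t
  by_cases h : (x : V) + t • v ∈ Reg Δ
  · simp [extend_of_mem _ h]
  · simp [extend_of_notMem _ h]

lemma HasDir.inv {v : V} {f f' : Reg Δ → ℝ} (hf : HasDir v f f') (h0 : ∀ x, f x ≠ 0) :
    HasDir v f⁻¹ (-f' * f⁻¹ ^ 2) := fun x => by
  have := (hf x).fun_inv (by simpa [extend_coe] using h0 x)
  simp only [zero_smul, add_zero, extend_coe] at this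
  convert! this using 2
  · rename_i t
    by_cases h : (x : V) + t • v ∈ Reg Δ
    · simp [extend_of_mem _ h]
    · simp [extend_of_notMem _ h]
  · simp [div_eq_mul_inv]

lemma hasDir_linFun (hΔ : Δ.Finite) (v : V) (φ : Module.Dual ℝ V) :
    HasDir v (linFun Δ φ) (fun _ => φ v) := fun x => by
  have h : HasDerivAt (fun t : ℝ => φ x + t * φ v) (φ v) 0 := by
    simpa using ((hasDerivAt_id (0 : ℝ)).mul_const (φ v)).const_add (φ x)
  refine h.congr_of_eventuallyEq ?_
  filter_upwards [eventually_mem_reg hΔ x v] with t ht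
  simp [extend_of_mem _ ht]

lemma hasDir_const (hΔ : Δ.Finite) (v : V) (c : ℝ) :
    HasDir v (fun _ : Reg Δ => c) 0 := fun x => by
  refine (hasDerivAt_const (0 : ℝ) c).congr_of_eventuallyEq ?_
  filter_upwards [eventually_mem_reg hΔ x v] with t ht
  simp [extend_of_mem _ ht]

lemma HasDir.smul (hΔ : Δ.Finite) {v : V} {f f' : Reg Δ → ℝ} (hf : HasDir v f f') (c : ℝ) :
    HasDir v (c • f) (c • f') := by
  have := (hasDir_const hΔ v c).mul hf
  refine this.congr ?_
  ext x; simp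

lemma hasDir_linFun_inv (hΔ : Δ.Finite) (v : V) {α : Module.Dual ℝ V} (hα : α ∈ Δ) :
    HasDir v (linFun Δ α)⁻¹ (-(α v) • (linFun Δ α)⁻¹ ^ 2) := by
  refine ((hasDir_linFun hΔ v α).inv fun x => x.2 α hα).congr ?_
  ext x; simp

lemma HasDir.pow {v : V} {f f' : Reg Δ → ℝ} (hf : HasDir v f f') (k : ℕ) :
    HasDir v (f ^ (k + 1)) (((k : ℝ) + 1) • (f' * f ^ k)) := by
  induction k with
  | zero => simpa using hf
  | succ k ih =>
    rw [pow_succ]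
    refine (ih.mul hf).congr ?_
    ext x; simp; ring

lemma hasDir_sum (hΔ : Δ.Finite) {v : V} {ι : Type*} (s : Finset ι) {f f' : ι → Reg Δ → ℝ}
    (h : ∀ i ∈ s, HasDir v (f i) (f' i)) : HasDir v (∑ i ∈ s, f i) (∑ i ∈ s, f' i) := by
  classical
  induction s using Finset.induction_on with
  | empty => exact hasDir_const hΔ v 0
  | insert a s ha ih =>
    rw [Finset.sum_insert ha, Finset.sum_insert ha]
    exact (h a (by simp)).add (ih fun i hi => h i (by simp [hi]))

/-- Derivatives of products in terms of logarithmic derivatives. -/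
lemma hasDir_prod (hΔ : Δ.Finite) {v : V} {ι : Type*} (s : Finset ι) {f l : ι → Reg Δ → ℝ}
    (h : ∀ i ∈ s, HasDir v (f i) (l i * f i)) :
    HasDir v (∏ i ∈ s, f i) ((∑ i ∈ s, l i) * ∏ i ∈ s, f i) := by
  classical
  induction s using Finset.induction_on with
  | empty => exact (hasDir_const hΔ v 1).congr (by simp)
  | insert a s ha ih =>
    rw [Finset.sum_insert ha, Finset.prod_insert ha]
    refine ((h a (by simp)).mul (ih fun i hi => h i (by simp [hi]))).congr ?_
    ring

lemma exists_hasDir (hΔ : Δ.Finite) (v : V) {f : Reg Δ → ℝ} (hf : f ∈ ratRing Δ) :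
    ∃ f' ∈ ratRing Δ, HasDir v f f' := by
  induction hf using Algebra.adjoin_induction with
  | mem f hf =>
    rcases hf with ⟨φ, rfl⟩ | ⟨α, hα, rfl⟩
    · exact ⟨_, (ratRing Δ).algebraMap_mem (φ v), hasDir_linFun hΔ v φ⟩
    · exact ⟨_, (ratRing Δ).smul_mem ((ratRing Δ).pow_mem (linFun_inv_mem hα) 2) _,
        hasDir_linFun_inv hΔ v hα⟩
  | algebraMap c => exact ⟨0, zero_mem _, hasDir_const hΔ v c⟩
  | add f g hf hg ihf ihg =>
    obtain ⟨f', hf', hf1⟩ := ihf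
    obtain ⟨g', hg', hg1⟩ := ihg
    exact ⟨_, add_mem hf' hg', hf1.add hg1⟩
  | mul f g hf hg ihf ihg =>
    obtain ⟨f', hf', hf1⟩ := ihf
    obtain ⟨g', hg', hg1⟩ := ihg
    exact ⟨_, add_mem (mul_mem hf' hg) (mul_mem hf hg'), hf1.mul hg1⟩

/-- The span of the derivatives of elements of `R_Δ`, as a space of functions. -/
def derivSpan (Δ : Set (Module.Dual ℝ V)) : Submodule ℝ (Reg Δ → ℝ) :=
  Submodule.span ℝ {f' | ∃ (v : V) (h : Reg Δ → ℝ), h ∈ ratRing Δ ∧ HasDir v h f'}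

lemma HasDir.mem_derivSpan {v : V} {f f' : Reg Δ → ℝ} (h : HasDir v f f') (hf : f ∈ ratRing Δ) :
    f' ∈ derivSpan Δ :=
  Submodule.subset_span ⟨v, f, hf, h⟩

/-- The function `1 / ∏ α` attached to a finite family of linear forms. -/
def invProd (Δ : Set (Module.Dual ℝ V)) {ι : Type*} [Fintype ι] (a : ι → Module.Dual ℝ V) :
    Reg Δ → ℝ :=
  ∏ i, (linFun Δ (a i))⁻¹

/-- The span of the functions `f_σ`, as a space of functions; the bases are given as families. -/
def simpleSpan (Δ : Set (Module.Dual ℝ V)) : Submodule ℝ (Reg Δ → ℝ) :=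
  Submodule.span ℝ {f | ∃ a : Fin (Module.finrank ℝ V) → Module.Dual ℝ V,
    (∀ i, a i ∈ Δ) ∧ LinearIndependent ℝ a ∧ f = invProd Δ a}

lemma invProd_mem {ι : Type*} [Fintype ι] {a : ι → Module.Dual ℝ V} (ha : ∀ i, a i ∈ Δ) :
    invProd Δ a ∈ ratRing Δ :=
  prod_mem fun i _ => linFun_inv_mem (ha i)

lemma derivSpan_le (hΔ : Δ.Finite) : derivSpan Δ ≤ Subalgebra.toSubmodule (ratRing Δ) := by
  refine Submodule.span_le.2 ?_
  rintro _ ⟨v, h, hh, hd⟩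
  obtain ⟨f, hf, hf'⟩ := exists_hasDir hΔ v hh
  rwa [← hd.dirDeriv_eq, hf'.dirDeriv_eq]

lemma map_derivSpace (hΔ : Δ.Finite) :
    (derivSpace Δ).map (ratRing Δ).val.toLinearMap = derivSpan Δ := by
  rw [derivSpace, derivSpan, Submodule.map_span]
  congr 1
  ext f
  constructor
  · rintro ⟨g, ⟨v, h, hg⟩, rfl⟩
    obtain ⟨f', -, hf⟩ := exists_hasDir hΔ v h.2
    refine ⟨v, h, h.2, ?_⟩
    rw [hf.dirDeriv_eq] at hg
    exact hf.congr hg.symm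
  · rintro ⟨v, h, hh, hd⟩
    exact ⟨⟨f, derivSpan_le hΔ (hd.mem_derivSpan hh)⟩, ⟨v, ⟨h, hh⟩, hd.dirDeriv_eq.symm⟩, rfl⟩

/-- Bases as finite sets and bases as families indexed by `Fin` give the same functions: a finite
set can be enumerated, and an independent family is injective, so its product is the product over
its image. -/
lemma map_simpleSpace [FiniteDimensional ℝ V] :
    (simpleSpace Δ).map (ratRing Δ).val.toLinearMap = simpleSpan Δ := by
  classical
  rw [simpleSpace, simpleSpan, Submodule.map_span]
  congr 1
  ext f
  constructor
  · rintro ⟨g, ⟨σ, ⟨hσ, hli, hsp⟩, hg⟩, rfl⟩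
    let b := Module.Basis.mk (v := fun α : σ => (α : Module.Dual ℝ V)) hli
      (by rw [Subtype.range_coe_subtype]; exact hsp.ge)
    have hc : Module.finrank ℝ V = Fintype.card σ := by
      rw [← Subspace.dual_finrank_eq, Module.finrank_eq_card_basis b]
    let ε : Fin (Module.finrank ℝ V) ≃ σ := (Fintype.equivFinOfCardEq hc.symm).symm
    refine ⟨fun i => ε i, fun i => hσ (ε i).2, hli.comp ε ε.injective, ?_⟩
    change (g : Reg Δ → ℝ) = _
    rw [hg]
    ext x
    simp only [invProd, one_div, Finset.prod_apply, Pi.inv_apply, linFun_apply]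
    rw [ε.prod_comp (fun α : σ => ((α : Module.Dual ℝ V) x)⁻¹), Finset.prod_inv_distrib,
      Finset.prod_coe_sort σ (fun α => α (x : V))]
  · rintro ⟨a, ha, hli, rfl⟩
    refine ⟨⟨_, invProd_mem ha⟩, ⟨Finset.univ.image a, ⟨?_, ?_, ?_⟩, ?_⟩, rfl⟩
    · simpa [Set.range_subset_iff] using ha
    · change LinearIndepOn ℝ id ((Finset.univ.image a : Finset _) : Set (Module.Dual ℝ V))
      rw [Finset.coe_image, Finset.coe_univ, Set.image_univ]
      exact hli.linearIndepOn_id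
    · simpa using hli.span_eq_top_of_card_eq_finrank' (by simp [Subspace.dual_finrank_eq])
    · ext x
      simp [invProd, Finset.prod_image hli.injective.injOn]

/-- Criterion for `R_Δ = S_Δ ⊕ ∂(V) R_Δ` in terms of spaces of functions. -/
lemma isCompl_of_span (hΔ : Δ.Finite) [FiniteDimensional ℝ V]
    (hd : simpleSpan Δ ⊓ derivSpan Δ = ⊥)
    (hs : Subalgebra.toSubmodule (ratRing Δ) ≤ simpleSpan Δ ⊔ derivSpan Δ) :
    IsCompl (simpleSpace Δ) (derivSpace Δ) := by
  have hinj : Function.Injective (ratRing Δ).val.toLinearMap := Subtype.val_injective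
  constructor
  · rw [disjoint_iff]
    apply Submodule.map_injective_of_injective hinj
    rw [Submodule.map_inf _ hinj, map_derivSpace hΔ, map_simpleSpace, hd, Submodule.map_bot]
  · rw [codisjoint_iff, eq_top_iff]
    intro f _
    have := hs f.2
    rw [← map_derivSpace hΔ, ← map_simpleSpace, ← Submodule.map_sup] at this
    obtain ⟨g, hg, hgf⟩ := this
    rwa [← hinj hgf]

lemma totalResidue_eq [FiniteDimensional ℝ V] (hΔ : Δ.Finite)
    (h : IsCompl (simpleSpace Δ) (derivSpace Δ))
    {f g : Reg Δ → ℝ} (hf : f ∈ ratRing Δ) (hg : g ∈ simpleSpan Δ) (hfg : f - g ∈ derivSpan Δ) :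
    ((totalResidue Δ ⟨f, hf⟩ : ratRing Δ) : Reg Δ → ℝ) = g := by
  rw [← map_simpleSpace] at hg
  rw [← map_derivSpace hΔ] at hfg
  obtain ⟨s, hs, rfl⟩ := hg
  obtain ⟨d, hd, hd'⟩ := hfg
  have e : (⟨f, hf⟩ : ratRing Δ) = s + d := Subtype.ext (by
    change f = (s : Reg Δ → ℝ) + d
    change (d : Reg Δ → ℝ) = f - s at hd'
    rw [hd', add_sub_cancel])
  rw [totalResidue, dif_pos h, e, map_add, Submodule.projectionOnto_apply_of_mem_left h hs,
    Submodule.projectionOnto_apply_of_mem_right h hd]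
  exact add_zero (s : Reg Δ → ℝ)

lemma comp_mem_Reg {W : Type*} [AddCommGroup W] [Module ℝ W] {Γ : Set (Module.Dual ℝ W)}
    {L : V →ₗ[ℝ] W} (hL : ∀ α ∈ Γ, α ∘ₗ L ∈ Δ) {x : V} (hx : x ∈ Reg Δ) : L x ∈ Reg Γ :=
  fun α hα => hx _ (hL α hα)

/-! ### Pullback of functions along linear maps -/

section Pullback

variable {W : Type*} [AddCommGroup W] [Module ℝ W] {Γ : Set (Module.Dual ℝ W)}

/-- Pullback of functions along a linear map that pulls `Γ` back into `Δ`. -/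
def pullback (L : V →ₗ[ℝ] W) (hL : ∀ α ∈ Γ, α ∘ₗ L ∈ Δ) : (Reg Γ → ℝ) →ₐ[ℝ] (Reg Δ → ℝ) where
  toFun f x := f ⟨L x, comp_mem_Reg hL x.2⟩
  map_one' := rfl
  map_mul' _ _ := rfl
  map_zero' := rfl
  map_add' _ _ := rfl
  commutes' _ := rfl

variable {L : V →ₗ[ℝ] W} (hL : ∀ α ∈ Γ, α ∘ₗ L ∈ Δ)

lemma pullback_apply (f : Reg Γ → ℝ) (x : Reg Δ) :
    pullback L hL f x = f ⟨L x, comp_mem_Reg hL x.2⟩ := rfl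

lemma pullback_mem {f : Reg Γ → ℝ} (hf : f ∈ ratRing Γ) : pullback L hL f ∈ ratRing Δ := by
  suffices ratRing Γ ≤ (ratRing Δ).comap (pullback L hL) from this hf
  refine Algebra.adjoin_le ?_
  rintro _ (⟨φ, rfl⟩ | ⟨α, hα, rfl⟩)
  · exact linFun_mem (φ ∘ₗ L)
  · exact linFun_inv_mem (hL α hα)

lemma HasDir.pullback (hΔ : Δ.Finite) (hΓ : Γ.Finite) {v : V} {f f' : Reg Γ → ℝ}
    (hf : HasDir (L v) f f') : HasDir v (pullback L hL f) (pullback L hL f') := fun x => by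
  refine (hf ⟨L x, comp_mem_Reg hL x.2⟩).congr_of_eventuallyEq ?_
  filter_upwards [eventually_mem_reg hΔ x v,
    eventually_mem_reg hΓ ⟨L x, comp_mem_Reg hL x.2⟩ (L v)] with t ht ht'
  rw [extend_of_mem _ ht, extend_of_mem _ ht', pullback_apply]
  simp

end Pullback

end General

end

/-! ### Type A roots in coordinates, and the passage from rank `n` to rank `n + 1` -/

/-- The restrictions of the coordinate forms `e^0, …, e^n` to `{x_n = 0}`. -/
def coordForm (n : ℕ) : Fin (n + 1) → Module.Dual ℝ (Fin n → ℝ) :=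
  Fin.snoc (α := fun _ => Module.Dual ℝ (Fin n → ℝ)) (fun i => LinearMap.proj i) 0

@[simp] lemma coordForm_castSucc (n : ℕ) (i : Fin n) (x : Fin n → ℝ) :
    coordForm n i.castSucc x = x i := by
  simp [coordForm]

@[simp] lemma coordForm_last (n : ℕ) (x : Fin n → ℝ) : coordForm n (Fin.last n) x = 0 := by
  simp [coordForm]

@[simp] lemma coordForm_zero (n : ℕ) (x : Fin (n + 1) → ℝ) : coordForm (n + 1) 0 x = x 0 :=
  coordForm_castSucc (n + 1) 0 x

/-- The root system of type `A_n`. -/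
def roots (n : ℕ) : Set (Module.Dual ℝ (Fin n → ℝ)) :=
  {α | ∃ i j, i ≠ j ∧ α = coordForm n i - coordForm n j}

lemma sub_mem_roots {n : ℕ} {i j : Fin (n + 1)} (h : i ≠ j) :
    coordForm n i - coordForm n j ∈ roots n := ⟨i, j, h, rfl⟩

lemma roots_finite (n : ℕ) : (roots n).Finite :=
  (Set.finite_range fun p : Fin (n + 1) × Fin (n + 1) =>
    coordForm n p.1 - coordForm n p.2).subset (by
      rintro _ ⟨i, j, -, rfl⟩
      exact ⟨(i, j), rfl⟩)

/-- Forgetting the coordinate `x_0`. -/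
def tailMap (n : ℕ) : (Fin (n + 1) → ℝ) →ₗ[ℝ] (Fin n → ℝ) := LinearMap.funLeft ℝ ℝ Fin.succ

@[simp] lemma tailMap_apply (n : ℕ) (x : Fin (n + 1) → ℝ) (i : Fin n) :
    tailMap n x i = x i.succ := rfl

@[simp] lemma tailMap_cons (n : ℕ) (t : ℝ) (x : Fin n → ℝ) :
    tailMap n (Fin.cons t x : Fin (n + 1) → ℝ) = x := by
  ext i; simp

lemma coordForm_succ (n : ℕ) (i : Fin (n + 1)) :
    coordForm (n + 1) i.succ = coordForm n i ∘ₗ tailMap n := by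
  refine LinearMap.ext fun x => ?_
  induction i using Fin.lastCases with
  | last => simp [Fin.succ_last]
  | cast i => rw [Fin.succ_castSucc, coordForm_castSucc]; simp

@[simp] lemma coordForm_succ_apply (n : ℕ) (i : Fin (n + 1)) (x : Fin (n + 1) → ℝ) :
    coordForm (n + 1) i.succ x = coordForm n i (tailMap n x) := by
  rw [coordForm_succ]; rfl

lemma comp_tailMap_mem {n : ℕ} : ∀ α ∈ roots n, α ∘ₗ tailMap n ∈ roots (n + 1) := by
  rintro _ ⟨i, j, hij, rfl⟩
  refine ⟨i.succ, j.succ, by simpa using hij, ?_⟩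
  rw [LinearMap.sub_comp, coordForm_succ, coordForm_succ]

/-- Functions of `x_1, …, x_n` as functions of `x_0, …, x_n`. -/
def pull (n : ℕ) : (Reg (roots n) → ℝ) →ₐ[ℝ] (Reg (roots (n + 1)) → ℝ) :=
  pullback (tailMap n) comp_tailMap_mem

lemma tail_mem_reg {n : ℕ} (x : Reg (roots (n + 1))) : tailMap n x ∈ Reg (roots n) :=
  comp_mem_Reg comp_tailMap_mem x.2

lemma pull_apply {n : ℕ} (f : Reg (roots n) → ℝ) (x : Reg (roots (n + 1))) :
    pull n f x = f ⟨tailMap n x, tail_mem_reg x⟩ := rfl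

lemma pull_mem {n : ℕ} {f : Reg (roots n) → ℝ} (hf : f ∈ ratRing (roots n)) :
    pull n f ∈ ratRing (roots (n + 1)) :=
  pullback_mem _ hf

lemma HasDir.pull {n : ℕ} {v : Fin (n + 1) → ℝ} {f f' : Reg (roots n) → ℝ}
    (hf : HasDir (tailMap n v) f f') : HasDir v (pull n f) (pull n f') :=
  HasDir.pullback _ (roots_finite _) (roots_finite _) hf

/-- The function `x_0`. -/
def yFun (n : ℕ) : Reg (roots (n + 1)) → ℝ := linFun _ (coordForm (n + 1) 0)

/-- The function `1 / (x_0 - x_{j+1})`. -/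
def invFun (n : ℕ) (j : Fin (n + 1)) : Reg (roots (n + 1)) → ℝ :=
  (linFun _ (coordForm (n + 1) 0 - coordForm (n + 1) j.succ))⁻¹

/-- The function `x_i`. -/
def xFun (n : ℕ) (i : Fin (n + 1)) : Reg (roots n) → ℝ := linFun _ (coordForm n i)

@[simp] lemma yFun_apply {n : ℕ} (x : Reg (roots (n + 1))) :
    yFun n x = (x : Fin (n + 1) → ℝ) 0 := by
  simp [yFun]

@[simp] lemma invFun_apply {n : ℕ} (j : Fin (n + 1)) (x : Reg (roots (n + 1))) :
    invFun n j x = ((x : Fin (n + 1) → ℝ) 0 - coordForm n j (tailMap n x))⁻¹ := by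
  simp [invFun]

lemma root_ne_zero {n : ℕ} (x : Reg (roots n)) {i j : Fin (n + 1)} (h : i ≠ j) :
    coordForm n i x - coordForm n j x ≠ 0 := x.2 _ (sub_mem_roots h)

lemma sub_ne_zero_of_reg {n : ℕ} (x : Reg (roots (n + 1))) (j : Fin (n + 1)) :
    (x : Fin (n + 1) → ℝ) 0 - coordForm n j (tailMap n x) ≠ 0 := by
  simpa using root_ne_zero x (Fin.succ_ne_zero j).symm

lemma yFun_mem (n : ℕ) : yFun n ∈ ratRing (roots (n + 1)) := linFun_mem _

lemma xFun_mem (n : ℕ) (i) : xFun n i ∈ ratRing (roots n) := linFun_mem _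

lemma invFun_mem (n : ℕ) (j : Fin (n + 1)) : invFun n j ∈ ratRing (roots (n + 1)) :=
  linFun_inv_mem (sub_mem_roots (Fin.succ_ne_zero j).symm)

/-- Division with remainder by `x_0 - x_{j+1}`. Together with `invFun_mul_invFun`, which separates
two distinct poles, it is all that the partial fraction expansion needs. -/
lemma yFun_mul_invFun (n : ℕ) (j : Fin (n + 1)) :
    yFun n * invFun n j = 1 + pull n (xFun n j) * invFun n j := by
  ext x
  have := sub_ne_zero_of_reg x j
  simp [pull_apply, xFun]
  field_simp
  ring

lemma invFun_mul_invFun (n : ℕ) {i j : Fin (n + 1)} (h : i ≠ j) :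
    invFun n i * invFun n j =
      pull n (linFun _ (coordForm n i - coordForm n j))⁻¹ * (invFun n i - invFun n j) := by
  ext x
  have h1 := sub_ne_zero_of_reg x j
  have h2 := sub_ne_zero_of_reg x i
  have h3 := root_ne_zero ⟨_, tail_mem_reg x⟩ h
  simp [pull_apply] at h3 ⊢
  field_simp
  ring

/-! ### Partial fractions in `x_0` -/

/-- The span of the terms of partial fraction expansions in `x_0`, with poles of order greater
than `m` only. -/
def fracSpan (n m : ℕ) : Submodule ℝ (Reg (roots (n + 1)) → ℝ) :=
  Submodule.span ℝ
    ({f | ∃ c ∈ ratRing (roots n), ∃ k : ℕ, f = pull n c * yFun n ^ k} ∪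
      {f | ∃ c ∈ ratRing (roots n), ∃ (j : Fin (n + 1)) (k : ℕ),
        f = pull n c * invFun n j ^ (k + m + 1)})

lemma pow_mem_fracSpan {n m : ℕ} {c : Reg (roots n) → ℝ} (hc : c ∈ ratRing (roots n)) (k : ℕ) :
    pull n c * yFun n ^ k ∈ fracSpan n m :=
  Submodule.subset_span (Or.inl ⟨c, hc, k, rfl⟩)

lemma inv_pow_mem_fracSpan {n m : ℕ} {c : Reg (roots n) → ℝ} (hc : c ∈ ratRing (roots n))
    (j : Fin (n + 1)) (k : ℕ) : pull n c * invFun n j ^ (k + m + 1) ∈ fracSpan n m :=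
  Submodule.subset_span (Or.inr ⟨c, hc, j, k, rfl⟩)

lemma mul_mem_fracSpan {n m : ℕ} {f : Reg (roots (n + 1)) → ℝ}
    (h1 : ∀ c ∈ ratRing (roots n), ∀ k : ℕ, f * (pull n c * yFun n ^ k) ∈ fracSpan n m)
    (h2 : ∀ c ∈ ratRing (roots n), ∀ (j : Fin (n + 1)) (k : ℕ),
      f * (pull n c * invFun n j ^ (k + m + 1)) ∈ fracSpan n m)
    {g : Reg (roots (n + 1)) → ℝ} (hg : g ∈ fracSpan n m) : f * g ∈ fracSpan n m := by
  induction hg using Submodule.span_induction with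
  | mem g hg =>
    rcases hg with ⟨c, hc, k, rfl⟩ | ⟨c, hc, j, k, rfl⟩
    · exact h1 c hc k
    · exact h2 c hc j k
  | zero => rw [mul_zero]; exact zero_mem _
  | add a b _ _ ha hb => rw [mul_add]; exact add_mem ha hb
  | smul t a _ ha => rw [mul_smul_comm]; exact Submodule.smul_mem _ _ ha

lemma pull_mul_mem_fracSpan {n m : ℕ} {d : Reg (roots n) → ℝ} (hd : d ∈ ratRing (roots n))
    {g : Reg (roots (n + 1)) → ℝ} (hg : g ∈ fracSpan n m) : pull n d * g ∈ fracSpan n m := by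
  refine mul_mem_fracSpan (fun c hc k => ?_) (fun c hc j k => ?_) hg
  · rw [← mul_assoc, ← map_mul]
    exact pow_mem_fracSpan (mul_mem hd hc) k
  · rw [← mul_assoc, ← map_mul]
    exact inv_pow_mem_fracSpan (mul_mem hd hc) j k

lemma yFun_mul_mem_fracSpan {n : ℕ} {g : Reg (roots (n + 1)) → ℝ} (hg : g ∈ fracSpan n 0) :
    yFun n * g ∈ fracSpan n 0 := by
  refine mul_mem_fracSpan (fun c hc k => ?_) (fun c hc j k => ?_) hg
  · convert! pow_mem_fracSpan (m := 0) hc (k + 1) using 1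
    ring
  · have e : yFun n * (pull n c * invFun n j ^ (k + 0 + 1)) =
        pull n c * invFun n j ^ k + pull n (c * xFun n j) * invFun n j ^ (k + 0 + 1) := by
      calc _ = pull n c * invFun n j ^ k * (yFun n * invFun n j) := by ring
        _ = _ := by rw [yFun_mul_invFun, map_mul]; ring
    rw [e]
    refine add_mem ?_ (inv_pow_mem_fracSpan (mul_mem hc (xFun_mem n j)) j k)
    cases k with
    | zero => simpa using pow_mem_fracSpan (m := 0) hc 0
    | succ k => exact inv_pow_mem_fracSpan (m := 0) hc j k

lemma invFun_mul_mem_fracSpan {n : ℕ} (i : Fin (n + 1)) {g : Reg (roots (n + 1)) → ℝ}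
    (hg : g ∈ fracSpan n 0) : invFun n i * g ∈ fracSpan n 0 := by
  refine mul_mem_fracSpan (fun c hc k => ?_) (fun c hc j k => ?_) hg
  · rw [mul_left_comm]
    refine pull_mul_mem_fracSpan hc ?_
    induction k with
    | zero => simpa using inv_pow_mem_fracSpan (m := 0) (one_mem _) i 0
    | succ k ih =>
      have e : invFun n i * yFun n ^ (k + 1) =
          pull n 1 * yFun n ^ k + pull n (xFun n i) * (invFun n i * yFun n ^ k) := by
        calc _ = yFun n ^ k * (yFun n * invFun n i) := by ring
          _ = _ := by rw [yFun_mul_invFun, map_one]; ring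
      rw [e]
      exact add_mem (pow_mem_fracSpan (one_mem _) k) (pull_mul_mem_fracSpan (xFun_mem n i) ih)
  · rw [mul_left_comm]
    refine pull_mul_mem_fracSpan hc ?_
    by_cases hij : i = j
    · subst hij
      convert! inv_pow_mem_fracSpan (m := 0) (one_mem _) i (k + 1) using 1
      rw [map_one]
      ring
    -- Distinct poles: each use of `invFun_mul_invFun` lowers the order at `x_{j+1}` by one, at the
    -- cost of a coefficient `1 / (x_{i+1} - x_{j+1})` in the ring of rank `n`.
    · have hd := linFun_inv_mem (sub_mem_roots hij)
      induction k with
      | zero =>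
        rw [zero_add, zero_add, pow_one, invFun_mul_invFun n hij]
        refine pull_mul_mem_fracSpan hd (sub_mem ?_ ?_)
        · simpa using inv_pow_mem_fracSpan (m := 0) (one_mem _) i 0
        · simpa using inv_pow_mem_fracSpan (m := 0) (one_mem _) j 0
      | succ k ih =>
        have e : invFun n i * invFun n j ^ (k + 1 + 0 + 1) =
            pull n (linFun _ (coordForm n i - coordForm n j))⁻¹ *
              (invFun n i * invFun n j ^ (k + 0 + 1) -
                pull n 1 * invFun n j ^ (k + 1 + 0 + 1)) := by
          calc _ = invFun n j ^ (k + 1) * (invFun n i * invFun n j) := by ring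
            _ = _ := by rw [invFun_mul_invFun n hij, map_one]; ring
        rw [e]
        exact pull_mul_mem_fracSpan hd
          (sub_mem ih (inv_pow_mem_fracSpan (m := 0) (one_mem _) j (k + 1)))

lemma linFun_eq_add {n : ℕ} (φ : Module.Dual ℝ (Fin (n + 1) → ℝ)) :
    linFun (roots (n + 1)) φ = φ (Pi.single 0 1) • yFun n +
      pull n (linFun _ (φ ∘ₗ LinearMap.pi (Fin.cases 0 fun i => LinearMap.proj i))) := by
  ext x
  have e : (x : Fin (n + 1) → ℝ) = (x : Fin (n + 1) → ℝ) 0 • Pi.single 0 1 +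
      (LinearMap.pi (Fin.cases 0 fun i => LinearMap.proj i) :
        (Fin n → ℝ) →ₗ[ℝ] (Fin (n + 1) → ℝ)) (tailMap n x) := by
    ext i
    induction i using Fin.cases <;> simp
  simp only [linFun_apply, Pi.add_apply, Pi.smul_apply, yFun_apply, pull_apply,
    LinearMap.comp_apply]
  conv_lhs => rw [e]
  simp [mul_comm]

/-- Partial fraction expansion in the variable `x_0`. -/
lemma mem_fracSpan {n : ℕ} {f : Reg (roots (n + 1)) → ℝ} (hf : f ∈ ratRing (roots (n + 1))) :
    f ∈ fracSpan n 0 := by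
  -- Stability of the span under multiplication passes through the ring operations of the
  -- adjunction, which mere membership would not.
  suffices ∀ g ∈ fracSpan n 0, f * g ∈ fracSpan n 0 by
    simpa using this (pull n 1 * yFun n ^ 0) (pow_mem_fracSpan (one_mem _) 0)
  induction hf using Algebra.adjoin_induction with
  | mem f hf =>
    intro g hg
    rcases hf with ⟨φ, rfl⟩ | ⟨_, ⟨i, j, hij, rfl⟩, rfl⟩
    · change linFun _ φ * g ∈ _
      rw [linFun_eq_add, add_mul, smul_mul_assoc]
      exact add_mem (Submodule.smul_mem _ _ (yFun_mul_mem_fracSpan hg))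
        (pull_mul_mem_fracSpan (linFun_mem _) hg)
    · induction i using Fin.cases with
      | zero =>
        induction j using Fin.cases with
        | zero => exact absurd rfl hij
        | succ j => exact invFun_mul_mem_fracSpan j hg
      | succ i =>
        induction j using Fin.cases with
        | zero =>
          convert! neg_mem (invFun_mul_mem_fracSpan i hg) using 1
          ext x
          simp only [Pi.mul_apply, Pi.neg_apply, invFun_apply, LinearMap.sub_apply,
            coordForm_zero, coordForm_succ_apply]
          rw [← neg_sub, inv_neg, neg_mul]
        | succ j =>
          have h := pull_mul_mem_fracSpan
            (linFun_inv_mem (sub_mem_roots (fun h => hij (congrArg _ h) : i ≠ j))) hg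
          convert! h using 1
          ext x
          simp [pull_apply]
  | algebraMap c =>
    intro g hg
    rw [← Algebra.smul_def]
    exact Submodule.smul_mem _ _ hg
  | add f g _ _ ihf ihg =>
    intro h hh
    rw [add_mul]
    exact add_mem (ihf h hh) (ihg h hh)
  | mul f g _ _ ihf ihg =>
    intro h hh
    rw [mul_assoc]
    exact ihf _ (ihg h hh)

section

open Filter Topology

/-! ### Derivatives and partial fractions -/

lemma hasDir_zero_dir {V : Type*} [AddCommGroup V] [Module ℝ V] {Δ : Set (Module.Dual ℝ V)}
    (f : Reg Δ → ℝ) : HasDir 0 f 0 := fun x => by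
  simpa using hasDerivAt_const (0 : ℝ) (f x)

lemma hasDir_yFun {n : ℕ} (v : Fin (n + 1) → ℝ) : HasDir v (yFun n) (fun _ => v 0) := by
  simpa [yFun] using hasDir_linFun (roots_finite _) v (coordForm (n + 1) 0)

lemma hasDir_invFun {n : ℕ} (v : Fin (n + 1) → ℝ) (j : Fin (n + 1)) :
    HasDir v (invFun n j) (-(v 0 - coordForm n j (tailMap n v)) • invFun n j ^ 2) := by
  have := hasDir_linFun_inv (roots_finite _) v (sub_mem_roots (Fin.succ_ne_zero j).symm)
  simpa [invFun] using this

lemma hasDir_pull_mul_pow {n : ℕ} {v : Fin (n + 1) → ℝ} {c c' : Reg (roots n) → ℝ}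
    (hc : HasDir (tailMap n v) c c') (k : ℕ) :
    HasDir v (pull n c * yFun n ^ (k + 1))
      (pull n c' * yFun n ^ (k + 1) + ((k + 1) * v 0 : ℝ) • (pull n c * yFun n ^ k)) := by
  refine (hc.pull.mul ((hasDir_yFun v).pow k)).congr ?_
  ext x; simp; ring

lemma hasDir_pull_mul_inv_pow {n : ℕ} {v : Fin (n + 1) → ℝ} {c c' : Reg (roots n) → ℝ}
    (hc : HasDir (tailMap n v) c c') (j : Fin (n + 1)) (k : ℕ) :
    HasDir v (pull n c * invFun n j ^ (k + 1))
      (pull n c' * invFun n j ^ (k + 1) +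
        (-(k + 1) * (v 0 - coordForm n j (tailMap n v)) : ℝ) •
          (pull n c * invFun n j ^ (k + 2))) := by
  refine (hc.pull.mul ((hasDir_invFun v j).pow k)).congr ?_
  ext x
  simp only [Pi.add_apply, Pi.mul_apply, Pi.smul_apply, Pi.pow_apply, smul_eq_mul]
  ring

lemma tailMap_single_zero (n : ℕ) : tailMap n (Pi.single 0 1) = 0 := by
  ext i; simp

/-- Integration in `x_0` raises the exponent and divides by `k + 1`, the coefficient being
independent of `x_0`. For poles of order at least two the same works in
`pull_mul_inv_pow_mem_derivSpan`; a simple pole would require a logarithm. -/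
lemma pull_mul_pow_mem_derivSpan {n : ℕ} {c : Reg (roots n) → ℝ} (hc : c ∈ ratRing (roots n))
    (k : ℕ) : pull n c * yFun n ^ k ∈ derivSpan (roots (n + 1)) := by
  have h := hasDir_pull_mul_pow (v := Pi.single 0 1) (c := c) (c' := 0)
    (by rw [tailMap_single_zero]; exact hasDir_zero_dir c) k
  have h1 := h.mem_derivSpan (mul_mem (pull_mem hc) (pow_mem (yFun_mem n) _))
  simp only [map_zero, zero_mul, zero_add, Pi.single_eq_same, mul_one] at h1
  exact (Submodule.smul_mem_iff _ (by positivity)).1 h1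

lemma pull_mul_inv_pow_mem_derivSpan {n : ℕ} {c : Reg (roots n) → ℝ} (hc : c ∈ ratRing (roots n))
    (j : Fin (n + 1)) (k : ℕ) : pull n c * invFun n j ^ (k + 2) ∈ derivSpan (roots (n + 1)) := by
  have h := hasDir_pull_mul_inv_pow (v := Pi.single 0 1) (c := c) (c' := 0)
    (by rw [tailMap_single_zero]; exact hasDir_zero_dir c) j k
  have h1 := h.mem_derivSpan (mul_mem (pull_mem hc) (pow_mem (invFun_mem n j) _))
  simp only [map_zero, zero_mul, zero_add, Pi.single_eq_same, tailMap_single_zero, sub_zero,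
    mul_one] at h1
  exact (Submodule.smul_mem_iff _ (neg_ne_zero.2 (by positivity))).1 h1

/-- The map `g ↦ g(x_1, …, x_n) / (x_0 - x_{j+1})` preserves derivatives. -/
lemma pull_mul_inv_mem_derivSpan {n : ℕ} {g : Reg (roots n) → ℝ} (hg : g ∈ derivSpan (roots n))
    (j : Fin (n + 1)) : pull n g * invFun n j ∈ derivSpan (roots (n + 1)) := by
  induction hg using Submodule.span_induction with
  | mem g hg =>
    obtain ⟨v, h, hh, hd⟩ := hg
    -- The direction `v` is lifted so that `x_0 - x_{j+1}` is constant along it; only the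
    -- coefficient gets differentiated.
    have := hasDir_pull_mul_inv_pow (v := Fin.cons (coordForm n j v) v) (c := h) (c' := g)
      (by simpa using hd) j 0
    have h1 := this.mem_derivSpan (mul_mem (pull_mem hh) (pow_mem (invFun_mem n j) _))
    simpa using h1
  | zero => simp
  | add a b _ _ ha hb => rw [map_add, add_mul]; exact add_mem ha hb
  | smul t a _ ha => rw [map_smul, smul_mul_assoc]; exact Submodule.smul_mem _ _ ha

/-- The map `(u_j) ↦ ∑_j u_j(x_1, …, x_n) / (x_0 - x_{j+1})`. -/
def polarMap (n : ℕ) : (Fin (n + 1) → Reg (roots n) → ℝ) →ₗ[ℝ] (Reg (roots (n + 1)) → ℝ) :=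
  ∑ j, LinearMap.mulRight ℝ (invFun n j) ∘ₗ (pull n).toLinearMap ∘ₗ LinearMap.proj j

lemma polarMap_apply {n : ℕ} (u : Fin (n + 1) → Reg (roots n) → ℝ) :
    polarMap n u = ∑ j, pull n (u j) * invFun n j := by
  simp [polarMap]

lemma polarMap_single {n : ℕ} (j : Fin (n + 1)) (u : Reg (roots n) → ℝ) :
    polarMap n (Pi.single j u) = pull n u * invFun n j := by
  rw [polarMap_apply, Finset.sum_eq_single j]
  · simp
  · intro i _ hi; simp [hi]
  · simp

/-- The image under `polarMap` of families with members in `D`. -/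
def polarImage (n : ℕ) (D : Submodule ℝ (Reg (roots n) → ℝ)) :
    Submodule ℝ (Reg (roots (n + 1)) → ℝ) :=
  (Submodule.pi Set.univ fun _ => D).map (polarMap n)

lemma pull_mul_inv_mem_polarImage {n : ℕ} {D : Submodule ℝ (Reg (roots n) → ℝ)}
    {u : Reg (roots n) → ℝ} (hu : u ∈ D) (j : Fin (n + 1)) :
    pull n u * invFun n j ∈ polarImage n D := by
  refine ⟨Pi.single j u, fun i _ => ?_, polarMap_single j u⟩
  by_cases h : i = j
  · subst h; simpa using hu
  · simp [h]

/-- The residues in `x_0` of a derivative are derivatives. -/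
lemma derivSpan_le_polar (n : ℕ) :
    derivSpan (roots (n + 1)) ≤ fracSpan n 1 ⊔ polarImage n (derivSpan (roots n)) := by
  refine Submodule.span_le.2 ?_
  rintro f' ⟨v, h, hh, hd⟩
  suffices ∃ g, HasDir v h g ∧ g ∈ fracSpan n 1 ⊔ polarImage n (derivSpan (roots n)) by
    obtain ⟨g, hg, hg'⟩ := this
    rw [← hd.dirDeriv_eq, hg.dirDeriv_eq]
    exact hg'
  -- Differentiating the expansion term by term, old simple poles contribute `c' / (x_0 - x_{j+1})`
  -- with `c'` a derivative, and the remaining terms have no simple pole.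
  replace hh := mem_fracSpan hh
  clear hd
  induction hh using Submodule.span_induction with
  | mem g hg =>
    rcases hg with ⟨c, hc, k, rfl⟩ | ⟨c, hc, j, k, rfl⟩
    · obtain ⟨c', hc', hcd⟩ := exists_hasDir (roots_finite n) (tailMap n v) hc
      cases k with
      | zero =>
        refine ⟨_, by simpa using hcd.pull, Submodule.mem_sup_left ?_⟩
        simpa using pow_mem_fracSpan (m := 1) hc' 0
      | succ k =>
        exact ⟨_, hasDir_pull_mul_pow hcd k, Submodule.mem_sup_left
          (add_mem (pow_mem_fracSpan hc' _) (Submodule.smul_mem _ _ (pow_mem_fracSpan hc _)))⟩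
    · obtain ⟨c', hc', hcd⟩ := exists_hasDir (roots_finite n) (tailMap n v) hc
      refine ⟨_, hasDir_pull_mul_inv_pow hcd j k, add_mem ?_ (Submodule.mem_sup_left
        (Submodule.smul_mem _ _ (inv_pow_mem_fracSpan hc j k)))⟩
      cases k with
      | zero =>
        refine Submodule.mem_sup_right ?_
        simpa using pull_mul_inv_mem_polarImage (hcd.mem_derivSpan hc) j
      | succ k => exact Submodule.mem_sup_left (inv_pow_mem_fracSpan hc' j k)
  | zero => exact ⟨0, hasDir_const (roots_finite _) v 0, zero_mem _⟩
  | add a b _ _ ha hb =>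
    obtain ⟨a', ha, ha'⟩ := ha
    obtain ⟨b', hb, hb'⟩ := hb
    exact ⟨_, ha.add hb, add_mem ha' hb'⟩
  | smul t a _ ha =>
    obtain ⟨a', ha, hmem⟩ := ha
    exact ⟨_, ha.smul (roots_finite _) t, Submodule.smul_mem _ _ hmem⟩

/-! ### Uniqueness of residues -/

lemma tendsto_pole (a b : ℝ) : Tendsto (fun s : ℝ => a + s⁻¹ - b) atTop (𝓝 (a - b)) := by
  simpa using (tendsto_inv_atTop_zero.const_add a).sub_const b

/-- The distinct poles `x_{i+1}` stay away from `x_{j+1}`, so points close enough to the pole, but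
not on it, are regular. -/
lemma eventually_cons_mem {n : ℕ} (j : Fin (n + 1)) (x : Reg (roots n)) :
    ∀ᶠ s : ℝ in atTop, (Fin.cons (coordForm n j x + s⁻¹) x : Fin (n + 1) → ℝ) ∈
      Reg (roots (n + 1)) := by
  have h : ∀ᶠ s : ℝ in atTop, ∀ i : Fin (n + 1),
      coordForm n j x + s⁻¹ - coordForm n i x ≠ 0 := by
    refine eventually_all.2 fun i => ?_
    by_cases hij : i = j
    · subst hij
      filter_upwards [eventually_gt_atTop 0] with s hs
      simpa using hs.ne'
    · exact (tendsto_pole _ _).eventually_ne (root_ne_zero x (Ne.symm hij))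
  filter_upwards [h] with s hs
  rintro _ ⟨i, l, hil, rfl⟩
  induction i using Fin.cases with
  | zero =>
    induction l using Fin.cases with
    | zero => exact absurd rfl hil
    | succ l => simpa using hs l
  | succ i =>
    induction l using Fin.cases with
    | zero =>
      intro h
      apply hs i
      simp at h
      linarith
    | succ l => simpa using root_ne_zero x (fun h => hil (congrArg _ h))

/-- The values of `f` at the points `x_0 = x_{j+1} + 1 / s`. -/
def nearPole {n : ℕ} (j : Fin (n + 1)) (x : Reg (roots n)) (f : Reg (roots (n + 1)) → ℝ) (s : ℝ) :
    ℝ :=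
  Function.extend Subtype.val f 0 (Fin.cons (coordForm n j x + s⁻¹) x : Fin (n + 1) → ℝ)

lemma nearPole_pull_mul {n : ℕ} (j : Fin (n + 1)) (x : Reg (roots n)) (c : Reg (roots n) → ℝ)
    (f : Reg (roots (n + 1)) → ℝ) :
    nearPole j x (pull n c * f) =ᶠ[atTop] fun s => c x * nearPole j x f s := by
  filter_upwards [eventually_cons_mem j x] with s hs
  simp [nearPole, extend_of_mem _ hs, pull_apply]

lemma nearPole_yFun_pow {n : ℕ} (j : Fin (n + 1)) (x : Reg (roots n)) (k : ℕ) :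
    nearPole j x (yFun n ^ k) =ᶠ[atTop] fun s => (coordForm n j x + s⁻¹) ^ k := by
  filter_upwards [eventually_cons_mem j x] with s hs
  simp [nearPole, extend_of_mem _ hs]

lemma nearPole_invFun_pow {n : ℕ} (j i : Fin (n + 1)) (x : Reg (roots n)) (k : ℕ) :
    nearPole j x (invFun n i ^ k) =ᶠ[atTop]
      fun s => (coordForm n j x + s⁻¹ - coordForm n i x)⁻¹ ^ k := by
  filter_upwards [eventually_cons_mem j x] with s hs
  simp [nearPole, extend_of_mem _ hs]

lemma nearPole_add {n : ℕ} (j : Fin (n + 1)) (x : Reg (roots n))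
    (f g : Reg (roots (n + 1)) → ℝ) :
    nearPole j x (f + g) =ᶠ[atTop] nearPole j x f + nearPole j x g := by
  filter_upwards [eventually_cons_mem j x] with s hs
  simp [nearPole, extend_of_mem _ hs]

lemma nearPole_smul {n : ℕ} (j : Fin (n + 1)) (x : Reg (roots n)) (c : ℝ)
    (f : Reg (roots (n + 1)) → ℝ) :
    nearPole j x (c • f) =ᶠ[atTop] c • nearPole j x f := by
  filter_upwards [eventually_cons_mem j x] with s hs
  simp [nearPole, extend_of_mem _ hs]

/-- `f` has polar part `P (1 / (x_0 - x_{j+1}))` at `x_0 = x_{j+1}`. -/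
def HasPolarPart {n : ℕ} (j : Fin (n + 1)) (x : Reg (roots n)) (f : Reg (roots (n + 1)) → ℝ)
    (P : Polynomial ℝ) : Prop :=
  (fun s => nearPole j x f s - P.eval s) =O[atTop] (fun _ => (1 : ℝ))

lemma HasPolarPart.add {n : ℕ} {j : Fin (n + 1)} {x : Reg (roots n)}
    {f g : Reg (roots (n + 1)) → ℝ} {P Q : Polynomial ℝ} (hf : HasPolarPart j x f P)
    (hg : HasPolarPart j x g Q) : HasPolarPart j x (f + g) (P + Q) := by
  refine (Asymptotics.IsBigO.add hf hg).congr' ?_ EventuallyEq.rfl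
  filter_upwards [nearPole_add j x f g] with s hs
  simp [hs]; ring

lemma HasPolarPart.smul {n : ℕ} {j : Fin (n + 1)} {x : Reg (roots n)}
    {f : Reg (roots (n + 1)) → ℝ} {P : Polynomial ℝ} (hf : HasPolarPart j x f P) (c : ℝ) :
    HasPolarPart j x (c • f) (c • P) := by
  refine (Asymptotics.IsBigO.const_mul_left hf c).congr' ?_ EventuallyEq.rfl
  filter_upwards [nearPole_smul j x c f] with s hs
  simp [hs]; ring

lemma hasPolarPart_of_tendsto {n : ℕ} {j : Fin (n + 1)} {x : Reg (roots n)}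
    {f : Reg (roots (n + 1)) → ℝ} {g : ℝ → ℝ} {l : ℝ} (hf : nearPole j x f =ᶠ[atTop] g)
    (hg : Tendsto g atTop (𝓝 l)) : HasPolarPart j x f 0 := by
  have := (hg.congr' hf.symm).isBigO_one ℝ
  simpa [HasPolarPart] using! this

lemma hasPolarPart_pow {n : ℕ} (j : Fin (n + 1)) (x : Reg (roots n)) (c : Reg (roots n) → ℝ)
    (k : ℕ) : HasPolarPart j x (pull n c * yFun n ^ k) 0 := by
  refine hasPolarPart_of_tendsto (g := fun s => c x * (coordForm n j x + s⁻¹) ^ k)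
    (l := c x * (coordForm n j x + 0) ^ k) ?_ ?_
  · filter_upwards [nearPole_pull_mul j x c (yFun n ^ k), nearPole_yFun_pow j x k] with s h1 h2
    rw [h1, h2]
  · exact ((tendsto_inv_atTop_zero.const_add _).pow k).const_mul _

lemma hasPolarPart_inv_pow_of_ne {n : ℕ} {i j : Fin (n + 1)} (hij : i ≠ j) (x : Reg (roots n))
    (c : Reg (roots n) → ℝ) (k : ℕ) : HasPolarPart j x (pull n c * invFun n i ^ k) 0 := by
  refine hasPolarPart_of_tendsto
    (g := fun s => c x * (coordForm n j x + s⁻¹ - coordForm n i x)⁻¹ ^ k)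
    (l := c x * (coordForm n j x - coordForm n i x)⁻¹ ^ k) ?_ ?_
  · filter_upwards [nearPole_pull_mul j x c (invFun n i ^ k), nearPole_invFun_pow j i x k]
      with s h1 h2
    rw [h1, h2]
  · exact (((tendsto_pole _ _).inv₀ (root_ne_zero x hij.symm)).pow k).const_mul _

lemma hasPolarPart_inv_pow {n : ℕ} (j : Fin (n + 1)) (x : Reg (roots n))
    (c : Reg (roots n) → ℝ) (k : ℕ) :
    HasPolarPart j x (pull n c * invFun n j ^ k) (Polynomial.C (c x) * Polynomial.X ^ k) := by
  refine (Asymptotics.isBigO_zero (fun _ => (1 : ℝ)) atTop).congr' ?_ EventuallyEq.rfl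
  filter_upwards [nearPole_pull_mul j x c (invFun n j ^ k), nearPole_invFun_pow j j x k]
    with s h1 h2
  rw [h1, h2]
  simp

lemma exists_hasPolarPart {n : ℕ} (j : Fin (n + 1)) (x : Reg (roots n))
    {f : Reg (roots (n + 1)) → ℝ} (hf : f ∈ fracSpan n 1) :
    ∃ P : Polynomial ℝ, P.coeff 1 = 0 ∧ HasPolarPart j x f P := by
  induction hf using Submodule.span_induction with
  | mem f hf =>
    rcases hf with ⟨c, -, k, rfl⟩ | ⟨c, -, i, k, rfl⟩
    · exact ⟨0, by simp, hasPolarPart_pow j x c k⟩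
    · by_cases hij : i = j
      · subst hij
        exact ⟨_, by simp [Polynomial.coeff_X_pow], hasPolarPart_inv_pow i x c _⟩
      · exact ⟨0, by simp, hasPolarPart_inv_pow_of_ne hij x c _⟩
  | zero => exact ⟨0, by simp, by simpa using hasPolarPart_pow j x 0 0⟩
  | add a b _ _ ha hb =>
    obtain ⟨P, hP, ha⟩ := ha
    obtain ⟨Q, hQ, hb⟩ := hb
    exact ⟨P + Q, by simp [hP, hQ], ha.add hb⟩
  | smul t a _ ha =>
    obtain ⟨P, hP, ha⟩ := ha
    exact ⟨t • P, by simp [hP], ha.smul t⟩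

lemma hasPolarPart_sum {n : ℕ} (j : Fin (n + 1)) (x : Reg (roots n)) {ι : Type*} (s : Finset ι)
    {f : ι → Reg (roots (n + 1)) → ℝ} {P : ι → Polynomial ℝ}
    (h : ∀ i ∈ s, HasPolarPart j x (f i) (P i)) :
    HasPolarPart j x (∑ i ∈ s, f i) (∑ i ∈ s, P i) := by
  classical
  induction s using Finset.induction_on with
  | empty => simpa using hasPolarPart_pow j x 0 0
  | insert a s ha ih =>
    rw [Finset.sum_insert ha, Finset.sum_insert ha]
    exact (h a (by simp)).add (ih fun i hi => h i (by simp [hi]))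

/-- The difference of two polar parts is a polynomial bounded at infinity, hence constant. Constant
terms are not determined, but the coefficient of `s`, which is the residue, is. -/
lemma HasPolarPart.coeff_eq {n : ℕ} {j : Fin (n + 1)} {x : Reg (roots n)}
    {f : Reg (roots (n + 1)) → ℝ} {P Q : Polynomial ℝ} (hP : HasPolarPart j x f P)
    (hQ : HasPolarPart j x f Q) : P.coeff 1 = Q.coeff 1 := by
  have h : (fun s => (P - Q).eval s) =O[atTop] (fun _ => (1 : ℝ)) :=
    (Asymptotics.IsBigO.sub hQ hP).congr_left fun s => by simp
  have hd : (P - Q).degree ≤ 0 :=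
    (Polynomial.isBoundedUnder_abs_atTop_iff _).1 (by
      simpa [Asymptotics.isBigO_one_iff] using! h)
  have := Polynomial.coeff_eq_zero_of_degree_lt (n := 1) (hd.trans_lt (by norm_num))
  rw [Polynomial.coeff_sub] at this
  linarith

/-- Residues are unique. -/
lemma eq_zero_of_polarMap_mem {n : ℕ} {u : Fin (n + 1) → Reg (roots n) → ℝ}
    (hu : polarMap n u ∈ fracSpan n 1) : u = 0 := by
  classical
  ext j x
  obtain ⟨P, hP, h1⟩ := exists_hasPolarPart j x hu
  rw [polarMap_apply] at h1
  have h2 := hasPolarPart_sum j x Finset.univ (f := fun i => pull n (u i) * invFun n i)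
    (P := fun i => if i = j then Polynomial.C (u j x) * Polynomial.X else 0) (fun i _ => by
      by_cases hij : i = j
      · subst hij
        simpa using hasPolarPart_inv_pow i x (u i) 1
      · simpa [hij] using hasPolarPart_inv_pow_of_ne hij x (u i) 1)
  have := h1.coeff_eq h2
  simpa [hP] using this.symm

end

/-! ### Simple elements -/

lemma simpleSpan_eq {V : Type*} [AddCommGroup V] [Module ℝ V] (Δ : Set (Module.Dual ℝ V)) {m : ℕ}
    (hm : Module.finrank ℝ V = m) :
    simpleSpan Δ = Submodule.span ℝ {f | ∃ a : Fin m → Module.Dual ℝ V,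
      (∀ i, a i ∈ Δ) ∧ LinearIndependent ℝ a ∧ f = invProd Δ a} := by
  subst hm; rfl

lemma invProd_mem_simpleSpan {n : ℕ} {a : Fin n → Module.Dual ℝ (Fin n → ℝ)}
    (ha : ∀ i, a i ∈ roots n) (hli : LinearIndependent ℝ a) :
    invProd (roots n) a ∈ simpleSpan (roots n) := by
  rw [simpleSpan_eq _ (Module.finrank_fin_fun ℝ)]
  exact Submodule.subset_span ⟨a, ha, hli, rfl⟩

lemma tailMap_surjective (n : ℕ) : Function.Surjective (tailMap n) := fun x =>
  ⟨Fin.cons 0 x, tailMap_cons n 0 x⟩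

lemma pull_invProd {n : ℕ} {ι : Type*} [Fintype ι] (a : ι → Module.Dual ℝ (Fin n → ℝ)) :
    pull n (invProd _ a) = ∏ i, (linFun (roots (n + 1)) (a i ∘ₗ tailMap n))⁻¹ := by
  rw [invProd, map_prod]; rfl

/-- Adjoining `x_0 - x_{j+1}` to a basis of rank `n` gives a basis of rank `n + 1`: the old forms
vanish on the vector `Pi.single 0 1`, the new one does not. -/
lemma pull_mul_inv_mem_simpleSpan {n : ℕ} {g : Reg (roots n) → ℝ} (hg : g ∈ simpleSpan (roots n))
    (j : Fin (n + 1)) : pull n g * invFun n j ∈ simpleSpan (roots (n + 1)) := by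
  rw [simpleSpan_eq _ (Module.finrank_fin_fun ℝ)] at hg
  induction hg using Submodule.span_induction with
  | mem g hg =>
    obtain ⟨a, ha, hli, rfl⟩ := hg
    have e : pull n (invProd (roots n) a) * invFun n j = invProd (roots (n + 1))
        (Fin.cons (coordForm (n + 1) 0 - coordForm (n + 1) j.succ)
          (fun i => a i ∘ₗ tailMap n)) := by
      rw [pull_invProd, mul_comm, invProd, Fin.prod_univ_succ]
      rfl
    rw [e]
    refine invProd_mem_simpleSpan ?_ (linearIndependent_finCons.2 ⟨?_, fun h => ?_⟩)
    · refine Fin.cases (sub_mem_roots (Fin.succ_ne_zero j).symm) fun i => ?_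
      exact comp_tailMap_mem _ (ha i)
    · exact hli.map' (tailMap n).dualMap (LinearMap.ker_eq_bot.2
        (LinearMap.dualMap_injective_of_surjective (tailMap_surjective n)))
    · have hle : Submodule.span ℝ (Set.range fun i => a i ∘ₗ tailMap n) ≤
          LinearMap.ker (Module.Dual.eval ℝ (Fin (n + 1) → ℝ) (Pi.single 0 1)) := by
        refine Submodule.span_le.2 ?_
        rintro _ ⟨i, rfl⟩
        simp [tailMap_single_zero]
      simpa [tailMap_single_zero] using hle h
  | zero => simp
  | add a b _ _ ha hb => rw [map_add, add_mul]; exact add_mem ha hb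
  | smul t a _ ha => rw [map_smul, smul_mul_assoc]; exact Submodule.smul_mem _ _ ha

lemma eq_smul_of_root {n : ℕ} {α : Module.Dual ℝ (Fin (n + 1) → ℝ)} (hα : α ∈ roots (n + 1))
    (h : α (Pi.single 0 1) ≠ 0) : ∃ (j : Fin (n + 1)) (t : ℝ), t ≠ 0 ∧
      α = t • (coordForm (n + 1) 0 - coordForm (n + 1) j.succ) := by
  obtain ⟨i, l, hil, rfl⟩ := hα
  induction i using Fin.cases with
  | zero =>
    induction l using Fin.cases with
    | zero => exact absurd rfl hil
    | succ l => exact ⟨l, 1, one_ne_zero, by simp⟩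
  | succ i =>
    induction l using Fin.cases with
    | zero => exact ⟨i, -1, by norm_num, by module⟩
    | succ l => simp [tailMap_single_zero] at h

lemma eq_comp_tailMap_of_root {n : ℕ} {α : Module.Dual ℝ (Fin (n + 1) → ℝ)}
    (hα : α ∈ roots (n + 1)) (h : α (Pi.single 0 1) = 0) :
    ∃ β ∈ roots n, α = β ∘ₗ tailMap n := by
  obtain ⟨i, l, hil, rfl⟩ := hα
  induction i using Fin.cases with
  | zero =>
    induction l using Fin.cases with
    | zero => exact absurd rfl hil
    | succ l => simp [tailMap_single_zero] at h
  | succ i =>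
    induction l using Fin.cases with
    | zero => simp [tailMap_single_zero] at h
    | succ l =>
      exact ⟨_, sub_mem_roots (fun h => hil (congrArg _ h)), by
        rw [coordForm_succ, coordForm_succ, LinearMap.sub_comp]⟩

lemma linFun_smul_inv {V : Type*} [AddCommGroup V] [Module ℝ V] {Δ : Set (Module.Dual ℝ V)}
    (t : ℝ) (α : Module.Dual ℝ V) : (linFun Δ (t • α))⁻¹ = t⁻¹ • (linFun Δ α)⁻¹ := by
  ext x; simp [mul_comm]

/-- The exchange relation between the functions `f_σ`. -/
lemma invProd_exchange {V : Type*} [AddCommGroup V] [Module ℝ V] {Δ : Set (Module.Dual ℝ V)}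
    {ι : Type*} [Fintype ι] [DecidableEq ι] {b : ι → Module.Dual ℝ V} (hb : ∀ i, b i ∈ Δ)
    {k l : ι} (hkl : k ≠ l) {γ : Module.Dual ℝ V} (hγ : γ ∈ Δ) {s t : ℝ}
    (h : γ = s • b l - t • b k) :
    invProd Δ b =
      s • invProd Δ (Function.update b l γ) - t • invProd Δ (Function.update b k γ) := by
  have key : ∀ c : ι → Module.Dual ℝ V, invProd Δ c = (linFun Δ (c k))⁻¹ *
      ((linFun Δ (c l))⁻¹ * ∏ i ∈ (Finset.univ.erase k).erase l, (linFun Δ (c i))⁻¹) := fun c => by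
    rw [invProd, Finset.mul_prod_erase _ (fun i => (linFun Δ (c i))⁻¹) (by simp [hkl.symm]),
      Finset.mul_prod_erase _ (fun i => (linFun Δ (c i))⁻¹) (by simp)]
  have hu : ∀ m, m = k ∨ m = l → ∏ i ∈ (Finset.univ.erase k).erase l,
      (linFun Δ (Function.update b m γ i))⁻¹ =
        ∏ i ∈ (Finset.univ.erase k).erase l, (linFun Δ (b i))⁻¹ := fun m hm => by
    refine Finset.prod_congr rfl fun i hi => ?_
    rw [Function.update_of_ne]
    rintro rfl
    simp at hi
    tauto
  rw [key b, key (Function.update b l γ), key (Function.update b k γ), hu k (.inl rfl),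
    hu l (.inr rfl)]
  generalize ∏ i ∈ (Finset.univ.erase k).erase l, (linFun Δ (b i))⁻¹ = p
  simp only [Function.update_self, Function.update_of_ne hkl, Function.update_of_ne hkl.symm]
  ext x
  have h1 : b k x ≠ 0 := x.2 _ (hb k)
  have h2 : b l x ≠ 0 := x.2 _ (hb l)
  have h3 : γ x ≠ 0 := x.2 _ hγ
  have h4 : γ x = s * b l x - t * b k x := by simp [h]
  simp only [Pi.mul_apply, Pi.sub_apply, Pi.smul_apply, Pi.inv_apply, linFun_apply, smul_eq_mul]
  field_simp
  rw [h4]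
  ring

/-- The coefficient `s` of `b l` in the new vector is nonzero, so the replacement can be undone. -/
lemma linearIndependent_update_sub {V : Type*} [AddCommGroup V] [Module ℝ V] {ι : Type*}
    [DecidableEq ι] {b : ι → V} (hli : LinearIndependent ℝ b) {k l : ι} (hkl : k ≠ l) {s t : ℝ}
    (hs : s ≠ 0) : LinearIndependent ℝ (Function.update b l (s • b l - t • b k)) := by
  refine hli.update l _ ⟨1, one_mem _, Finsupp.single l s - Finsupp.single k t, ?_, ?_⟩
  · simpa [hkl] using hs
  · simp

/-- The residues in `x_0` of a simple element are simple. -/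
lemma invProd_mem_polarImage {n : ℕ} {b : Fin (n + 1) → Module.Dual ℝ (Fin (n + 1) → ℝ)}
    (hb : ∀ i, b i ∈ roots (n + 1)) (hli : LinearIndependent ℝ b) :
    invProd (roots (n + 1)) b ∈ polarImage n (simpleSpan (roots n)) := by
  induction hN : (Finset.univ.filter fun i => b i (Pi.single 0 1) ≠ 0).card
    using Nat.strong_induction_on generalizing b with
  | _ N ih =>
  -- Induction on the number of forms involving `x_0`. Two such forms are proportional to `x_0 -
  -- x_{j+1}` and `x_0 - x_{i+1}`; the root `x_{j+1} - x_{i+1}` can be exchanged for either,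
  -- lowering the number.
  by_cases hex : ∃ k l, k ≠ l ∧ b k (Pi.single 0 1) ≠ 0 ∧ b l (Pi.single 0 1) ≠ 0
  · obtain ⟨k, l, hkl, hk, hl⟩ := hex
    obtain ⟨j, t, ht, hkj⟩ := eq_smul_of_root (hb k) hk
    obtain ⟨i, s, hs, hli'⟩ := eq_smul_of_root (hb l) hl
    have hij : i ≠ j := by
      rintro rfl
      have := (linearIndependent_update_sub hli hkl (s := s⁻¹) (t := t⁻¹)
        (inv_ne_zero hs)).ne_zero l
      rw [Function.update_self, hkj, hli', smul_smul, smul_smul, inv_mul_cancel₀ hs,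
        inv_mul_cancel₀ ht] at this
      simp at this
    have hγ : coordForm (n + 1) j.succ - coordForm (n + 1) i.succ = s⁻¹ • b l - t⁻¹ • b k := by
      rw [hkj, hli', smul_smul, smul_smul, inv_mul_cancel₀ hs, inv_mul_cancel₀ ht]
      simp
    have hγm : coordForm (n + 1) j.succ - coordForm (n + 1) i.succ ∈ roots (n + 1) :=
      sub_mem_roots (by simpa using hij.symm)
    have hγ0 : (coordForm (n + 1) j.succ - coordForm (n + 1) i.succ) (Pi.single 0 1) = 0 := by
      simp [tailMap_single_zero]
    have hmem : ∀ m, ∀ i', Function.update b m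
        (coordForm (n + 1) j.succ - coordForm (n + 1) i.succ) i' ∈ roots (n + 1) := by
      intro m i'
      by_cases h : i' = m
      · subst h; simpa using hγm
      · simpa [h] using hb i'
    have hcard : ∀ m, b m (Pi.single 0 1) ≠ 0 → (Finset.univ.filter fun i' =>
        Function.update b m (coordForm (n + 1) j.succ - coordForm (n + 1) i.succ) i'
          (Pi.single 0 1) ≠ 0).card < N := by
      intro m hm
      rw [← hN]
      refine Finset.card_lt_card (Finset.ssubset_iff_subset_ne.2 ⟨fun i' hi' => ?_, fun h => ?_⟩)
      · by_cases h : i' = m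
        · subst h; simpa using hm
        · simpa [h] using hi'
      · have : m ∈ Finset.univ.filter fun i' => b i' (Pi.single 0 1) ≠ 0 := by simpa using hm
        rw [← h] at this
        simp [hγ0] at this
    rw [invProd_exchange hb hkl hγm hγ]
    refine sub_mem (Submodule.smul_mem _ _ ?_) (Submodule.smul_mem _ _ ?_)
    · exact ih _ (hcard l hl) (hmem l) (hγ ▸ linearIndependent_update_sub hli hkl
        (inv_ne_zero hs)) rfl
    · refine ih _ (hcard k hk) (hmem k) ?_ rfl
      -- The same root, read with `k` and `l` interchanged; this accounts for the signs.
      have h := linearIndependent_update_sub hli hkl.symm (s := -t⁻¹) (t := -s⁻¹)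
        (neg_ne_zero.2 (inv_ne_zero ht))
      convert! h using 2
      rw [hγ]
      module
  · push Not at hex
    -- A basis cannot vanish entirely on `Pi.single 0 1`, so exactly one form involves `x_0`. It
    -- supplies the simple pole, and the others form a basis of rank `n`.
    obtain ⟨k, hk⟩ : ∃ k, b k (Pi.single 0 1) ≠ 0 := by
      by_contra! h
      have hle : Submodule.span ℝ (Set.range b) ≤
          LinearMap.ker (Module.Dual.eval ℝ (Fin (n + 1) → ℝ) (Pi.single 0 1)) := by
        refine Submodule.span_le.2 ?_
        rintro _ ⟨i, rfl⟩
        simpa using h i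
      rw [hli.span_eq_top_of_card_eq_finrank' (by simp [Subspace.dual_finrank_eq])] at hle
      have := hle (Submodule.mem_top (x := coordForm (n + 1) 0))
      simp at this
    obtain ⟨j, t, -, hkj⟩ := eq_smul_of_root (hb k) hk
    have h0 : ∀ i : Fin n, b (Equiv.swap 0 k i.succ) (Pi.single 0 1) = 0 := fun i => by
      refine hex k _ ?_ hk
      intro h
      have h' := congrArg (Equiv.swap 0 k) h
      rw [Equiv.swap_apply_self, Equiv.swap_apply_right] at h'
      exact Fin.succ_ne_zero i h'.symm
    choose a ha hba using fun i => eq_comp_tailMap_of_root (hb _) (h0 i)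
    have e : invProd (roots (n + 1)) b = t⁻¹ • (pull n (invProd (roots n) a) * invFun n j) := by
      rw [pull_invProd, invProd, ← Equiv.prod_comp (Equiv.swap 0 k), Fin.prod_univ_succ,
        Equiv.swap_apply_left, hkj, linFun_smul_inv, smul_mul_assoc, mul_comm]
      simp only [hba]
      rfl
    rw [e]
    refine Submodule.smul_mem _ _ (pull_mul_inv_mem_polarImage (invProd_mem_simpleSpan ha ?_) j)
    refine LinearIndependent.of_comp (tailMap n).dualMap ?_
    have h := hli.comp _ ((Equiv.swap 0 k).injective.comp (Fin.succ_injective n))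
    convert! h using 1
    ext1 i
    exact (hba i).symm

lemma simpleSpan_le_polarImage (n : ℕ) :
    simpleSpan (roots (n + 1)) ≤ polarImage n (simpleSpan (roots n)) := by
  rw [simpleSpan_eq _ (Module.finrank_fin_fun ℝ)]
  refine Submodule.span_le.2 ?_
  rintro _ ⟨b, hb, hli, rfl⟩
  exact invProd_mem_polarImage hb hli

/-- By uniqueness of residues, the residues in `x_0` of a common element are both simple and
derivatives, hence zero by induction; and a simple element is determined by its residues. In rank
zero there are no nonzero directions. -/
lemma simpleSpan_inf_derivSpan (n : ℕ) : simpleSpan (roots n) ⊓ derivSpan (roots n) = ⊥ := by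
  induction n with
  | zero =>
    have : derivSpan (roots 0) = ⊥ := by
      refine (Submodule.eq_bot_iff _).2 fun f hf => ?_
      have hle : derivSpan (roots 0) ≤ ⊥ := by
        refine Submodule.span_le.2 ?_
        rintro _ ⟨v, h, -, hd⟩
        obtain rfl : v = 0 := Subsingleton.elim _ _
        exact hd.dirDeriv_eq.symm.trans (hasDir_zero_dir h).dirDeriv_eq
      exact hle hf
    rw [this, inf_bot_eq]
  | succ n ih =>
    refine (Submodule.eq_bot_iff _).2 ?_
    rintro f ⟨hs, hd⟩
    obtain ⟨g, hg, rfl⟩ := simpleSpan_le_polarImage n hs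
    obtain ⟨p, hp, _, ⟨d, hd', rfl⟩, h⟩ := Submodule.mem_sup.1 (derivSpan_le_polar n hd)
    have h0 : g - d = 0 := eq_zero_of_polarMap_mem (by
      rw [map_sub, ← h, add_sub_cancel_right]; exact hp)
    rw [sub_eq_zero] at h0
    subst h0
    have : g = 0 := by
      funext j
      have : g j ∈ simpleSpan (roots n) ⊓ derivSpan (roots n) :=
        ⟨hg j (Set.mem_univ j), hd' j (Set.mem_univ j)⟩
      rw [ih] at this
      exact this
    rw [this, map_zero]

lemma ratRing_le_sup (n : ℕ) :
    Subalgebra.toSubmodule (ratRing (roots n)) ≤ simpleSpan (roots n) ⊔ derivSpan (roots n) := by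
  induction n with
  | zero =>
    intro f _
    refine Submodule.mem_sup_left ?_
    have h1 : (1 : Reg (roots 0) → ℝ) ∈ simpleSpan (roots 0) := by
      simpa [invProd] using invProd_mem_simpleSpan (n := 0) (a := Fin.elim0) (fun i => i.elim0)
        linearIndependent_empty_type
    have hx : (0 : Fin 0 → ℝ) ∈ Reg (roots 0) := by
      rintro _ ⟨i, j, hij, rfl⟩
      exact absurd (Subsingleton.elim (α := Fin 1) i j) hij
    have : f = f ⟨0, hx⟩ • (1 : Reg (roots 0) → ℝ) := by
      ext x
      rw [show x = ⟨0, hx⟩ from Subsingleton.elim _ _]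
      simp
    rw [this]
    exact Submodule.smul_mem _ _ h1
  | succ n ih =>
    intro f hf
    refine (Submodule.span_le.2 ?_ : fracSpan n 0 ≤ _) (mem_fracSpan hf)
    rintro _ (⟨c, hc, k, rfl⟩ | ⟨c, hc, j, k, rfl⟩)
    · exact Submodule.mem_sup_right (pull_mul_pow_mem_derivSpan hc k)
    · cases k with
      | succ k => exact Submodule.mem_sup_right (pull_mul_inv_pow_mem_derivSpan hc j k)
      | zero =>
        obtain ⟨s, hs, d, hd, rfl⟩ := Submodule.mem_sup.1 (ih hc)
        have := add_mem
          (Submodule.mem_sup_left (T := derivSpan (roots (n + 1)))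
            (pull_mul_inv_mem_simpleSpan hs j))
          (Submodule.mem_sup_right (pull_mul_inv_mem_derivSpan hd j))
        simpa [add_mul] using this

lemma isCompl_roots (n : ℕ) : IsCompl (simpleSpace (roots n)) (derivSpace (roots n)) :=
  isCompl_of_span (roots_finite n) (simpleSpan_inf_derivSpan n) (ratRing_le_sup n)

/-! ### Elementary symmetric polynomials -/

section ElemSymm

variable {ι A : Type*} [CommRing A]

/-- The elementary symmetric polynomial of degree `k` in the `z i`, `i ∈ s`. -/
def elemSymm (z : ι → A) (s : Finset ι) (k : ℕ) : A :=
  ∑ J ∈ s.powersetCard k, ∏ i ∈ J, z i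

lemma elemSymm_zero (z : ι → A) (s : Finset ι) : elemSymm z s 0 = 1 := by
  simp [elemSymm]

lemma elemSymm_card (z : ι → A) (s : Finset ι) : elemSymm z s s.card = ∏ i ∈ s, z i := by
  simp [elemSymm]

variable [DecidableEq ι]

lemma elemSymm_insert (z : ι → A) {s : Finset ι} {i : ι} (hi : i ∉ s) (k : ℕ) :
    elemSymm z (insert i s) (k + 1) = elemSymm z s (k + 1) + z i * elemSymm z s k := by
  have hJ : ∀ {m : ℕ}, ∀ J ∈ s.powersetCard m, i ∉ J := fun J hJ h =>
    hi ((Finset.mem_powersetCard.1 hJ).1 h)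
  rw [elemSymm, Finset.powersetCard_succ_insert hi, Finset.sum_union, Finset.sum_image,
    elemSymm, elemSymm, Finset.mul_sum]
  · congr 1
    exact Finset.sum_congr rfl fun J h => Finset.prod_insert (hJ J h)
  · intro J h J' h' e
    rw [← Finset.erase_insert (hJ J h), ← Finset.erase_insert (hJ J' h'), e]
  · rw [Finset.disjoint_left]
    intro J h h'
    obtain ⟨J', -, rfl⟩ := Finset.mem_image.1 h'
    exact hJ _ h (Finset.mem_insert_self _ _)

/-- Double counting: a `k`-subset `J` occurs once for every `i` in `s \ J`. -/
lemma sum_elemSymm_erase (z : ι → A) (s : Finset ι) (k : ℕ) :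
    ∑ i ∈ s, elemSymm z (s.erase i) k = ((s.card : A) - k) * elemSymm z s k := by
  simp only [elemSymm]
  rw [Finset.sum_comm' (t' := s.powersetCard k) (s' := fun J => s \ J), Finset.mul_sum]
  · refine Finset.sum_congr rfl fun J hJ => ?_
    obtain ⟨hJs, rfl⟩ := Finset.mem_powersetCard.1 hJ
    rw [Finset.sum_const, nsmul_eq_mul, Finset.card_sdiff_of_subset hJs,
      Nat.cast_sub (Finset.card_le_card hJs)]
  · intro i J
    simp only [Finset.mem_powersetCard, Finset.mem_sdiff, Finset.subset_erase]
    tauto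

lemma sum_sum_elemSymm_erase (z : ι → A) (s : Finset ι) (k : ℕ) :
    ∑ i ∈ s, ∑ j ∈ s.erase i, elemSymm z ((s.erase i).erase j) k =
      ((s.card : A) - k) * ((s.card : A) - k - 1) * elemSymm z s k := by
  rw [mul_right_comm, ← sum_elemSymm_erase, Finset.sum_mul]
  refine Finset.sum_congr rfl fun i hi => ?_
  rw [sum_elemSymm_erase, Finset.card_erase_of_mem hi,
    Nat.cast_sub (Finset.card_pos.2 ⟨i, hi⟩)]
  push_cast
  ring

end ElemSymm

/-- Divided differences of `x_i (y - x_i) e_m` with `z_i = y - x_i` omitted from `e_m`. -/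
lemma divided_difference_elemSymm {ι : Type*} [DecidableEq ι] (x : ι → ℝ) (y : ℝ) (s : Finset ι)
    (m : ℕ) {i j : ι} (hi : i ∈ s) (hj : j ∈ s) (hij : x i - x j ≠ 0) (z : ι → ℝ)
    (hz : ∀ i, z i = y - x i) :
    (x i * z i * elemSymm z (s.erase i) m - x j * z j * elemSymm z (s.erase j) m) *
        (x i - x j)⁻¹ =
      elemSymm z s (m + 1) - elemSymm z ((s.erase i).erase j) (m + 1) -
        y * elemSymm z ((s.erase i).erase j) m := by
  have hne : i ≠ j := by rintro rfl; simp at hij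
  have h1 : s.erase i = insert j ((s.erase i).erase j) :=
    (Finset.insert_erase (Finset.mem_erase.2 ⟨hne.symm, hj⟩)).symm
  have h2 : s.erase j = insert i ((s.erase i).erase j) := by
    rw [Finset.erase_right_comm]
    exact (Finset.insert_erase (Finset.mem_erase.2 ⟨hne, hi⟩)).symm
  have h3 : s = insert i (insert j ((s.erase i).erase j)) := by
    rw [← h1, Finset.insert_erase hi]
  have hiU : i ∉ insert j ((s.erase i).erase j) := by simp [hne]
  have hiU' : i ∉ (s.erase i).erase j := by simp
  have hjU : j ∉ (s.erase i).erase j := by simp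
  -- Once `z_i` and `z_j` are split off, only elementary symmetric polynomials of the remaining set
  -- `U` occur, and the claim is a polynomial identity. Degree `m = 0` is separate because `e_{m-1}`
  -- would be needed.
  generalize (s.erase i).erase j = U at *
  rw [← div_eq_mul_inv, div_eq_iff hij]
  rw [h1, h2, h3]
  cases m with
  | zero =>
    simp only [elemSymm_insert _ hiU, elemSymm_insert _ hjU, elemSymm_zero, hz]
    ring
  | succ m =>
    simp only [elemSymm_insert _ hiU, elemSymm_insert _ hjU, elemSymm_insert _ hiU', hz]
    ring

/-- The divided differences are symmetric in `i` and `j`, so twice the sum runs over ordered pairs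
and `sum_sum_elemSymm_erase` evaluates it. The first coefficient is `n (n - 1) - (n - m - 1) (n - m
- 2)`. -/
lemma sum_divided_difference {n : ℕ} (x : Fin n → ℝ) (y : ℝ) (m : ℕ)
    (hx : ∀ i j, i ≠ j → x i - x j ≠ 0) (z : Fin n → ℝ) (hz : ∀ i, z i = y - x i) :
    2 * ∑ i, ∑ j ∈ Finset.Ioi i,
      (x i * z i * elemSymm z (Finset.univ.erase i) m -
        x j * z j * elemSymm z (Finset.univ.erase j) m) * (x i - x j)⁻¹ =
      ((m : ℝ) + 1) * (2 * n - m - 2) * elemSymm z Finset.univ (m + 1) -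
        ((n : ℝ) - m) * (n - m - 1) * (y * elemSymm z Finset.univ m) := by
  set F : Fin n → Fin n → ℝ := fun i j => elemSymm z Finset.univ (m + 1) -
    elemSymm z ((Finset.univ.erase i).erase j) (m + 1) -
      y * elemSymm z ((Finset.univ.erase i).erase j) m with hF
  have hsymm : ∀ i j, F i j = F j i := fun i j => by
    simp only [hF, Finset.erase_right_comm]
  have e1 : ∑ i, ∑ j ∈ Finset.Ioi i, (x i * z i * elemSymm z (Finset.univ.erase i) m -
        x j * z j * elemSymm z (Finset.univ.erase j) m) * (x i - x j)⁻¹ =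
      ∑ i, ∑ j ∈ Finset.Ioi i, F i j :=
    Finset.sum_congr rfl fun i _ => Finset.sum_congr rfl fun j hj =>
      divided_difference_elemSymm x y _ m (Finset.mem_univ i) (Finset.mem_univ j)
        (hx i j (Finset.mem_Ioi.1 hj).ne) z hz
  have e2 : 2 * ∑ i, ∑ j ∈ Finset.Ioi i, F i j = ∑ i, ∑ j ∈ Finset.univ.erase i, F i j := by
    have := Finset.sum_sum_Ioi_add_eq_sum_sum_off_diag F
    simp only [← Finset.compl_singleton]
    rw [Finset.mul_sum]
    refine (Finset.sum_congr rfl fun i _ => ?_).trans (this.trans ?_)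
    · rw [Finset.mul_sum]
      exact Finset.sum_congr rfl fun j _ => by rw [hsymm j i]; ring
    · exact Finset.sum_congr rfl fun i _ => Finset.sum_congr rfl fun j _ => hsymm j i
  rw [e1, e2]
  simp only [hF, Finset.sum_sub_distrib, ← Finset.mul_sum, sum_sum_elemSymm_erase,
    Finset.sum_const, Finset.card_univ, Fintype.card_fin]
  have hc : ∀ i : Fin n, ((Finset.univ.erase i).card : ℝ) = n - 1 := fun i => by
    rw [Finset.card_erase_of_mem (Finset.mem_univ i), Finset.card_univ, Fintype.card_fin,
      Nat.cast_sub (by have := i.2; omega)]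
    simp
  simp only [nsmul_eq_mul, hc, Finset.sum_const, Finset.card_univ, Fintype.card_fin]
  push_cast
  ring

/-! ### The recursion in `R / ∂(V) R` -/

section Recursion

variable {n : ℕ}

/-- The linear form `x_{i+1}`, `i < n`. -/
def midForm (n : ℕ) (i : Fin n) : Module.Dual ℝ (Fin (n + 1) → ℝ) :=
  coordForm (n + 1) i.castSucc.succ

@[simp] lemma midForm_apply (i : Fin n) (x : Fin (n + 1) → ℝ) : midForm n i x = x i.succ := by
  simp [midForm]

/-- The function `x_0 - x_{i+1}`. -/
def zFun (n : ℕ) (i : Fin n) : Reg (roots (n + 1)) → ℝ :=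
  linFun _ (coordForm (n + 1) 0 - midForm n i)

@[simp] lemma zFun_apply (i : Fin n) (x : Reg (roots (n + 1))) :
    zFun n i x = (x : Fin (n + 1) → ℝ) 0 - (x : Fin (n + 1) → ℝ) i.succ := by
  simp [zFun]

lemma zFun_inv (i : Fin n) : (zFun n i)⁻¹ = invFun n i.castSucc := rfl

/-- The function `1 / ∏_{i < j} (x_i - x_j)`. -/
def vandInv (n : ℕ) : Reg (roots n) → ℝ :=
  ∏ i : Fin (n + 1), ∏ j ∈ Finset.Ioi i, (linFun _ (coordForm n i - coordForm n j))⁻¹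

lemma vandInv_mem (n : ℕ) : vandInv n ∈ ratRing (roots n) :=
  prod_mem fun _ _ => prod_mem fun _ hj => linFun_inv_mem (sub_mem_roots (Finset.mem_Ioi.1 hj).ne)

lemma vandInv_succ (n : ℕ) :
    vandInv (n + 1) = (∏ j, invFun n j) * pull n (vandInv n) := by
  rw [vandInv, Fin.prod_univ_succ, vandInv, map_prod]
  simp only [map_prod, Fin.prod_Ioi_zero, Fin.prod_Ioi_succ]
  congr 1
  refine Finset.prod_congr rfl fun i _ => Finset.prod_congr rfl fun j _ => ?_
  rw [coordForm_succ, coordForm_succ, ← LinearMap.sub_comp]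
  rfl

lemma prod_Ioi_castSucc {M : Type*} [CommMonoid M] (f : Fin (n + 1) → M) (i : Fin n) :
    ∏ j ∈ Finset.Ioi i.castSucc, f j =
      f (Fin.last n) * ∏ j ∈ Finset.Ioi i, f j.castSucc := by
  rw [← Finset.filter_lt_eq_Ioi, ← Finset.filter_lt_eq_Ioi, Finset.prod_filter,
    Finset.prod_filter, Fin.prod_univ_castSucc, mul_comm]
  simp [Fin.castSucc_lt_last]

/-- The function `1 / ∏_{i < j} (x_i - x_j)`, where `x_n = 0` does not occur. -/
def vandInvMid (n : ℕ) : Reg (roots (n + 1)) → ℝ :=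
  ∏ i : Fin n, ∏ j ∈ Finset.Ioi i, (linFun _ (midForm n i - midForm n j))⁻¹

/-- The function `1 / x_{i+1}`, `i < n`. -/
def xInv (n : ℕ) (i : Fin n) : Reg (roots (n + 1)) → ℝ :=
  (linFun _ (midForm n i - coordForm (n + 1) (Fin.last n).succ))⁻¹

@[simp] lemma xInv_apply (i : Fin n) (x : Reg (roots (n + 1))) :
    xInv n i x = ((x : Fin (n + 1) → ℝ) i.succ)⁻¹ := by
  simp [xInv]

lemma midForm_sub_mem {i j : Fin n} (h : i ≠ j) : midForm n i - midForm n j ∈ roots (n + 1) :=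
  sub_mem_roots (by simpa using h)

lemma midForm_sub_last_mem (i : Fin n) :
    midForm n i - coordForm (n + 1) (Fin.last n).succ ∈ roots (n + 1) :=
  sub_mem_roots (by simp)

lemma zForm_mem (i : Fin n) : coordForm (n + 1) 0 - midForm n i ∈ roots (n + 1) :=
  sub_mem_roots (Fin.succ_ne_zero _).symm

lemma pull_vandInv (n : ℕ) : pull n (vandInv n) = (∏ i, xInv n i) * vandInvMid n := by
  rw [vandInv, Fin.prod_univ_castSucc]
  simp only [prod_Ioi_castSucc, Finset.prod_mul_distrib, map_mul, map_prod]
  ext x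
  simp [pull_apply, vandInvMid, Fin.top_eq_last]

lemma hasDir_linFun_of_eq_zero {v : Fin n → ℝ} {α : Module.Dual ℝ (Fin n → ℝ)} (h : α v = 0) :
    HasDir v (linFun (roots n) α) 0 := by
  refine (hasDir_linFun (roots_finite n) v α).congr ?_
  ext x; simp [h]

lemma hasDir_linFun_inv_of_eq_zero {v : Fin n → ℝ} {α : Module.Dual ℝ (Fin n → ℝ)}
    (hα : α ∈ roots n) (h : α v = 0) : HasDir v (linFun (roots n) α)⁻¹ 0 := by
  refine (hasDir_linFun_inv (roots_finite n) v hα).congr ?_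
  simp [h]

lemma HasDir.mul_zero_dir {v : Fin n → ℝ} {f g : Reg (roots n) → ℝ} (hf : HasDir v f 0)
    (hg : HasDir v g 0) : HasDir v (f * g) 0 :=
  (hf.mul hg).congr (by simp)

lemma hasDir_prod_zero {v : Fin n → ℝ} {ι : Type*} (s : Finset ι) {f : ι → Reg (roots n) → ℝ}
    (h : ∀ i ∈ s, HasDir v (f i) 0) : HasDir v (∏ i ∈ s, f i) 0 := by
  have := hasDir_prod (roots_finite n) s (f := f) (l := 0) (v := v)
    (fun i hi => (h i hi).congr (by simp))
  exact this.congr (by simp)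

lemma hasDir_elemSymm_zero {v : Fin n → ℝ} {ι : Type*} (s : Finset ι)
    {f : ι → Reg (roots n) → ℝ} (h : ∀ i ∈ s, HasDir v (f i) 0) (k : ℕ) :
    HasDir v (elemSymm f s k) 0 := by
  have := hasDir_sum (roots_finite n) (s.powersetCard k) (v := v) (f := fun J => ∏ i ∈ J, f i)
    (f' := 0) fun J hJ => hasDir_prod_zero J fun i hi => h i ((Finset.mem_powersetCard.1 hJ).1 hi)
  exact this.congr (by simp)

lemma elemSymm_mem {ι : Type*} (s : Finset ι)
    {f : ι → Reg (roots n) → ℝ} (h : ∀ i ∈ s, f i ∈ ratRing (roots n)) (k : ℕ) :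
    elemSymm f s k ∈ ratRing (roots n) :=
  sum_mem fun _ hJ => prod_mem fun i hi => h i ((Finset.mem_powersetCard.1 hJ).1 hi)

lemma elemSymm_apply {X ι : Type*} (s : Finset ι) (f : ι → X → ℝ) (k : ℕ) (x : X) :
    elemSymm f s k x = elemSymm (fun i => f i x) s k := by
  simp [elemSymm, Finset.sum_apply, Finset.prod_apply]

lemma hasDir_vandInvMid (i : Fin n) :
    HasDir (Pi.single i.succ 1) (vandInvMid n)
      ((∑ a, ∑ b ∈ Finset.Ioi a,
        (-((Pi.single i 1 : Fin n → ℝ) a - (Pi.single i 1 : Fin n → ℝ) b)) •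
          (linFun _ (midForm n a - midForm n b))⁻¹) * vandInvMid n) := by
  refine hasDir_prod (roots_finite _) _ fun a _ => hasDir_prod (roots_finite _) _ fun b hb => ?_
  refine (hasDir_linFun_inv (roots_finite _) _ (midForm_sub_mem (Finset.mem_Ioi.1 hb).ne)).congr ?_
  rw [pow_two, smul_mul_assoc]
  congr 2
  simp [Pi.single_apply]

/-- The basic relation between the classes of the functions
`e_k(z) q / (∏ x_i ∏ z_i ∏_{i<j} (x_i - x_j))` with `z_i = x_0 - x_i`. -/
lemma elemSymm_relation (m : ℕ) {q : Reg (roots (n + 1)) → ℝ} (hq : q ∈ ratRing (roots (n + 1)))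
    (hq' : ∀ i : Fin n, HasDir (Pi.single i.succ 1) q 0) :
    (((m : ℝ) + 1) * (2 * n - m - 2)) • (q * elemSymm (zFun n) Finset.univ (m + 1) *
        ((∏ i : Fin n, invFun n i.castSucc) * pull n (vandInv n))) -
      (((n : ℝ) - m) * (n - m - 1)) • (yFun n * q * elemSymm (zFun n) Finset.univ m *
        ((∏ i : Fin n, invFun n i.castSucc) * pull n (vandInv n))) ∈
      derivSpan (roots (n + 1)) := by
  -- The factors indexed by `i` are omitted, so `c i` is constant along the `i`-th middle variable
  -- and the derivative falls on the Vandermonde factor only. Over the full denominator this is a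
  -- numerator `x_i z_i e_m`, with `z_i` left out of `e_m`.
  set c : Fin n → Reg (roots (n + 1)) → ℝ := fun i =>
    q * elemSymm (zFun n) (Finset.univ.erase i) m *
      ∏ l ∈ Finset.univ.erase i, (invFun n l.castSucc * xInv n l) with hc
  have hcR : ∀ i, c i * vandInvMid n ∈ ratRing (roots (n + 1)) := fun i =>
    mul_mem (mul_mem (mul_mem hq (elemSymm_mem _ (fun _ _ => linFun_mem _) _))
      (prod_mem fun l _ => mul_mem (invFun_mem _ _) (linFun_inv_mem (midForm_sub_last_mem l))))
      (prod_mem fun _ _ => prod_mem fun _ hb =>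
        linFun_inv_mem (midForm_sub_mem (Finset.mem_Ioi.1 hb).ne))
  have hcD : ∀ i : Fin n, HasDir (Pi.single i.succ 1) (c i) 0 := fun i => by
    have hi : ∀ l ∈ Finset.univ.erase i,
        (Pi.single i.succ 1 : Fin (n + 1) → ℝ) l.succ = 0 := fun l hl =>
      Pi.single_eq_of_ne (by simpa using Finset.ne_of_mem_erase hl) _
    refine ((hq' i).mul_zero_dir (hasDir_elemSymm_zero _ (fun l hl => ?_) _)).mul_zero_dir
      (hasDir_prod_zero _ fun l hl => HasDir.mul_zero_dir ?_ ?_)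
    · exact hasDir_linFun_of_eq_zero (by simp [hi l hl])
    · exact hasDir_linFun_inv_of_eq_zero (zForm_mem l) (by simp [hi l hl])
    · exact hasDir_linFun_inv_of_eq_zero (midForm_sub_last_mem l) (by simp [hi l hl])
  have hmem := fun i => (((hcD i).mul (hasDir_vandInvMid i)).mem_derivSpan (hcR i))
  -- The sign undoes that of the derivative of an inverse, and the two matches the passage to
  -- ordered pairs in `sum_divided_difference`.
  have hsum := Submodule.smul_mem _ (-2 : ℝ)
    (Submodule.sum_mem (derivSpan (roots (n + 1))) (t := Finset.univ) fun i _ => hmem i)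
  convert! hsum using 1
  funext x
  have hx : ∀ i : Fin n, (x : Fin (n + 1) → ℝ) i.succ ≠ 0 := fun i => by
    simpa using x.2 _ (midForm_sub_last_mem i)
  have hz : ∀ i : Fin n, (x : Fin (n + 1) → ℝ) 0 - (x : Fin (n + 1) → ℝ) i.succ ≠ 0 := fun i => by
    simpa using x.2 _ (zForm_mem i)
  have hxx : ∀ i j : Fin n, i ≠ j →
      (x : Fin (n + 1) → ℝ) i.succ - (x : Fin (n + 1) → ℝ) j.succ ≠ 0 := fun i j h => by
    simpa using x.2 _ (midForm_sub_mem h)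
  have key := sum_divided_difference (fun i : Fin n => (x : Fin (n + 1) → ℝ) i.succ)
    ((x : Fin (n + 1) → ℝ) 0) m hxx (fun i => zFun n i x) (fun i => zFun_apply i x)
  set W : ℝ := (∏ i : Fin n, invFun n i.castSucc x) * ((∏ i, xInv n i x) * vandInvMid n x) with hW
  have hci : ∀ i, c i x * vandInvMid n x = q x * W * ((x : Fin (n + 1) → ℝ) i.succ * zFun n i x *
      elemSymm (fun i => zFun n i x) (Finset.univ.erase i) m) := fun i => by
    simp only [hc, hW, Pi.mul_apply, elemSymm_apply, Finset.prod_apply, Finset.prod_mul_distrib]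
    rw [← Finset.mul_prod_erase Finset.univ (fun i : Fin n => invFun n i.castSucc x)
      (Finset.mem_univ i), ← Finset.mul_prod_erase Finset.univ (fun i : Fin n => xInv n i x)
      (Finset.mem_univ i), ← zFun_inv, Pi.inv_apply, xInv_apply, zFun_apply]
    have h1 := hx i
    have h2 := hz i
    field_simp
  have hL : (((m : ℝ) + 1) * (2 * n - m - 2)) • (q * elemSymm (zFun n) Finset.univ (m + 1) *
        ((∏ i : Fin n, invFun n i.castSucc) * pull n (vandInv n))) x -
      (((n : ℝ) - m) * (n - m - 1)) • (yFun n * q * elemSymm (zFun n) Finset.univ m *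
        ((∏ i : Fin n, invFun n i.castSucc) * pull n (vandInv n))) x =
      q x * W * (((m : ℝ) + 1) * (2 * n - m - 2) *
          elemSymm (fun i => zFun n i x) Finset.univ (m + 1) -
        ((n : ℝ) - m) * (n - m - 1) * ((x : Fin (n + 1) → ℝ) 0 *
          elemSymm (fun i => zFun n i x) Finset.univ m)) := by
    simp only [pull_vandInv, hW, Pi.mul_apply, elemSymm_apply, Finset.prod_apply, yFun_apply,
      smul_eq_mul]
    ring
  rw [Pi.sub_apply, Pi.smul_apply, Pi.smul_apply, hL, ← key]
  simp only [Pi.smul_apply, Finset.sum_apply, Pi.mul_apply, zero_mul,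
    zero_add, smul_eq_mul, Pi.inv_apply, linFun_apply, LinearMap.sub_apply, midForm_apply]
  have hR : ∀ i, c i x * ((∑ a, ∑ b ∈ Finset.Ioi a,
      -((Pi.single i 1 : Fin n → ℝ) a - (Pi.single i 1 : Fin n → ℝ) b) *
        ((x : Fin (n + 1) → ℝ) a.succ - (x : Fin (n + 1) → ℝ) b.succ)⁻¹) * vandInvMid n x) =
      ∑ a, ∑ b ∈ Finset.Ioi a, -(((Pi.single i 1 : Fin n → ℝ) a - (Pi.single i 1 : Fin n → ℝ) b) *
        (c i x * vandInvMid n x)) *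
        ((x : Fin (n + 1) → ℝ) a.succ - (x : Fin (n + 1) → ℝ) b.succ)⁻¹ := fun i => by
    rw [mul_left_comm, Finset.sum_mul]
    refine Finset.sum_congr rfl fun a _ => ?_
    rw [Finset.sum_mul]
    exact Finset.sum_congr rfl fun b _ => by ring
  simp only [hR]
  rw [Finset.sum_comm, Finset.mul_sum, Finset.mul_sum, Finset.mul_sum]
  refine Finset.sum_congr rfl fun a _ => ?_
  rw [Finset.sum_comm, Finset.mul_sum, Finset.mul_sum, Finset.mul_sum]
  refine Finset.sum_congr rfl fun b _ => ?_
  -- The factor `1 / (x_a - x_b)` is affected by the derivatives along `a` and `b` only, with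
  -- opposite signs: a divided difference appears.
  have hs : ∑ i, (((Pi.single i 1 : Fin n → ℝ) a - (Pi.single i 1 : Fin n → ℝ) b) *
      (c i x * vandInvMid n x)) = c a x * vandInvMid n x - c b x * vandInvMid n x := by
    simp [sub_mul, Finset.sum_sub_distrib, Pi.single_apply]
  rw [← Finset.sum_mul, Finset.sum_neg_distrib, hs, hci, hci]
  ring

end Recursion

/-! ### The total residue of the Morris function -/

lemma yFun_mul_invFun_last (n : ℕ) : yFun n * invFun n (Fin.last n) = 1 := by
  rw [yFun_mul_invFun]
  ext x
  simp [pull_apply, xFun]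

/-- `x_0 ^ p - x_{j+1} ^ p` is divisible by `x_0 - x_{j+1}`, so the difference is polynomial in
`x_0` and has a primitive. -/
lemma pull_mul_pow_mul_inv_sub_mem {n : ℕ} {c : Reg (roots n) → ℝ} (hc : c ∈ ratRing (roots n))
    (j : Fin (n + 1)) (p : ℕ) :
    pull n c * (yFun n ^ p * invFun n j) - pull n (xFun n j ^ p * c) * invFun n j ∈
      derivSpan (roots (n + 1)) := by
  induction p generalizing c with
  | zero => simp
  | succ p ih =>
    have e : pull n c * (yFun n ^ (p + 1) * invFun n j) -
        pull n (xFun n j ^ (p + 1) * c) * invFun n j = pull n c * yFun n ^ p +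
          (pull n (c * xFun n j) * (yFun n ^ p * invFun n j) -
            pull n (xFun n j ^ p * (c * xFun n j)) * invFun n j) := by
      calc _ = pull n c * (yFun n ^ p * (yFun n * invFun n j)) -
          pull n (xFun n j ^ (p + 1) * c) * invFun n j := by ring
        _ = _ := by
          rw [yFun_mul_invFun]
          simp only [map_mul, map_pow]
          ring
    rw [e]
    exact add_mem (pull_mul_pow_mem_derivSpan hc p) (ih (mul_mem hc (xFun_mem n j)))

/-- The function `x_0^(p-k-1) e_k(z) / (∏ x_i ∏ z_i ∏_{i<j} (x_i - x_j))`, `z_i = x_0 - x_i`. -/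
def aomotoFun (n p k : ℕ) : Reg (roots (n + 1)) → ℝ :=
  yFun n ^ p * invFun n (Fin.last n) ^ (k + 1) * elemSymm (zFun n) Finset.univ k *
    ((∏ i : Fin n, invFun n i.castSucc) * pull n (vandInv n))

lemma aomotoFun_zero (n p : ℕ) :
    aomotoFun n p 0 = yFun n ^ p * vandInv (n + 1) := by
  rw [aomotoFun, vandInv_succ, elemSymm_zero, Fin.prod_univ_castSucc]
  ring

lemma aomotoFun_relation (n p m : ℕ) :
    (((m : ℝ) + 1) * (2 * n - m - 2)) • aomotoFun n p (m + 1) -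
      (((n : ℝ) - m) * (n - m - 1)) • aomotoFun n p m ∈ derivSpan (roots (n + 1)) := by
  have h := elemSymm_relation (n := n) m
    (q := yFun n ^ p * invFun n (Fin.last n) ^ (m + 2))
    (mul_mem (pow_mem (yFun_mem n) _) (pow_mem (invFun_mem n _) _)) (fun i => by
      have h1 : HasDir (Pi.single i.succ 1) (yFun n) 0 :=
        hasDir_linFun_of_eq_zero (by simp)
      have h2 : HasDir (Pi.single i.succ 1) (invFun n (Fin.last n)) 0 :=
        hasDir_linFun_inv_of_eq_zero (sub_mem_roots (Fin.succ_ne_zero _).symm)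
          (by simp)
      rw [← Fin.prod_const, ← Fin.prod_const]
      exact (hasDir_prod_zero _ fun _ _ => h1).mul_zero_dir (hasDir_prod_zero _ fun _ _ => h2))
  have e : yFun n * (yFun n ^ p * invFun n (Fin.last n) ^ (m + 2)) =
      yFun n ^ p * invFun n (Fin.last n) ^ (m + 1) := by
    calc _ = yFun n ^ p * invFun n (Fin.last n) ^ (m + 1) *
        (yFun n * invFun n (Fin.last n)) := by ring
      _ = _ := by rw [yFun_mul_invFun_last, mul_one]
  rw [e] at h
  exact h

/-- The constant is the telescoping product of the ratios in `aomotoFun_relation`, written with `d =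
N - m` to avoid natural subtraction. At `d = 0` it is the Catalan number `(2N)! / (N! (N+1)!)`. -/
lemma aomotoFun_zero_sub_mem (p N m d : ℕ) (h : N = m + d) :
    aomotoFun (N + 1) p 0 -
      ((m.factorial * (2 * N).factorial * (d + 1).factorial * d.factorial : ℝ) /
        ((N + d).factorial * (N + 1).factorial * N.factorial)) • aomotoFun (N + 1) p m ∈
      derivSpan (roots (N + 1 + 1)) := by
  induction m generalizing d with
  | zero =>
    obtain rfl : N = d := by omega
    rw [← two_mul]
    have : ((Nat.factorial 0 * (2 * N).factorial * (N + 1).factorial * N.factorial : ℝ) /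
        ((2 * N).factorial * (N + 1).factorial * N.factorial)) = 1 := by
      rw [Nat.factorial_zero, Nat.cast_one, one_mul]
      exact div_self (by positivity)
    rw [this, one_smul, sub_self]
    exact zero_mem _
  | succ m ih =>
    have h1 := ih (d + 1) (by omega)
    have h2 := aomotoFun_relation (N + 1) p m
    have hN : (N : ℝ) = m + 1 + d := by rw [h]; push_cast; ring
    have e1 : ((m : ℝ) + 1) * (2 * ((N + 1 : ℕ) : ℝ) - m - 2) = (m + 1) * (N + d + 1) := by
      push_cast; rw [hN]; ring
    have e2 : (((N + 1 : ℕ) : ℝ) - m) * (((N + 1 : ℕ) : ℝ) - m - 1) = (d + 2) * (d + 1) := by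
      push_cast; rw [hN]; ring
    rw [e1, e2] at h2
    set c : ℝ := (m.factorial * (2 * N).factorial * (d + 1 + 1).factorial * (d + 1).factorial : ℝ) /
        ((N + (d + 1)).factorial * (N + 1).factorial * N.factorial) with hc
    have h3 := sub_mem h1 (Submodule.smul_mem _ (c / ((d + 2) * (d + 1))) h2)
    convert! h3 using 1
    have e3 : ((m + 1).factorial * (2 * N).factorial * (d + 1).factorial * d.factorial : ℝ) /
        ((N + d).factorial * (N + 1).factorial * N.factorial) =
          c / ((d + 2) * (d + 1)) * ((m + 1) * (N + d + 1)) := by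
      rw [hc, ← add_assoc N d 1, Nat.factorial_succ (N + d), Nat.factorial_succ (d + 1),
        Nat.factorial_succ m]
      simp only [Nat.factorial_succ d]
      push_cast
      field_simp
      ring
    rw [e3, smul_sub, smul_smul, smul_smul, div_mul_cancel₀ c (by positivity)]
    abel

/-- There are `N + 1` variables `z_i`, so `e_N(z) / ∏ z_i` is the sum of the `1 / z_j`. The pole of
order `N + 1` at `x_0 = 0` is cancelled by as many factors `x_0` in the numerator. -/
lemma aomotoFun_top (N p : ℕ) :
    aomotoFun (N + 1) (p + (N + 1)) N = ∑ j : Fin (N + 1),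
      pull (N + 1) (vandInv (N + 1)) * (yFun (N + 1) ^ p * invFun (N + 1) j.castSucc) := by
  have h1 : yFun (N + 1) ^ (p + (N + 1)) * invFun (N + 1) (Fin.last (N + 1)) ^ (N + 1) =
      yFun (N + 1) ^ p := by
    rw [pow_add, mul_assoc, ← mul_pow, yFun_mul_invFun_last, one_pow, mul_one]
  have h2 : elemSymm (zFun (N + 1)) Finset.univ N =
      ∑ j, ∏ l ∈ Finset.univ.erase j, zFun (N + 1) l := by
    have h := sum_elemSymm_erase (zFun (N + 1)) Finset.univ N
    rw [Finset.card_univ, Fintype.card_fin, Nat.cast_add, Nat.cast_one, add_sub_cancel_left,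
      one_mul] at h
    rw [← h]
    refine Finset.sum_congr rfl fun j _ => ?_
    rw [← elemSymm_card, Finset.card_erase_of_mem (Finset.mem_univ j), Finset.card_univ,
      Fintype.card_fin, Nat.add_sub_cancel]
  have h3 : ∀ j, (∏ l ∈ Finset.univ.erase j, zFun (N + 1) l) *
      ∏ i : Fin (N + 1), invFun (N + 1) i.castSucc = invFun (N + 1) j.castSucc := fun j => by
    rw [← Finset.mul_prod_erase Finset.univ (fun i : Fin (N + 1) => invFun (N + 1) i.castSucc)
      (Finset.mem_univ j), mul_left_comm, ← Finset.prod_mul_distrib, Finset.prod_eq_one, mul_one]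
    intro l _
    ext x
    have : zFun (N + 1) l x ≠ 0 := x.2 _ (zForm_mem l)
    rw [← zFun_inv, Pi.mul_apply, Pi.inv_apply, mul_inv_cancel₀ this, Pi.one_apply]
  rw [aomotoFun, h1, h2, Finset.mul_sum, Finset.sum_mul]
  refine Finset.sum_congr rfl fun j _ => ?_
  rw [← h3 j]
  ring

/-! ### Permutations of the coordinates -/

lemma vandInv_apply {n : ℕ} (x : Reg (roots n)) :
    vandInv n x = (∏ i, ((x : Fin n → ℝ) i)⁻¹) *
      ∏ i : Fin n, ∏ j ∈ Finset.Ioi i, ((x : Fin n → ℝ) i - (x : Fin n → ℝ) j)⁻¹ := by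
  rw [vandInv, Fin.prod_univ_castSucc]
  simp only [prod_Ioi_castSucc, Finset.prod_mul_distrib]
  simp [Fin.top_eq_last]

lemma comp_funLeft_mem {n : ℕ} (w : Equiv.Perm (Fin n)) :
    ∀ α ∈ roots n, α ∘ₗ LinearMap.funLeft ℝ ℝ w ∈ roots n := by
  have hl : coordForm n (Fin.last n) ∘ₗ LinearMap.funLeft ℝ ℝ w = coordForm n (Fin.last n) :=
    LinearMap.ext fun x => by simp
  have hc : ∀ i : Fin n, coordForm n i.castSucc ∘ₗ LinearMap.funLeft ℝ ℝ w =
      coordForm n (w i).castSucc := fun i => LinearMap.ext fun x => by simp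
  rintro _ ⟨i, j, hij, rfl⟩
  rw [LinearMap.sub_comp]
  induction i using Fin.lastCases with
  | last =>
    induction j using Fin.lastCases with
    | last => exact absurd rfl hij
    | cast j => rw [hl, hc]; exact sub_mem_roots (Fin.castSucc_lt_last _).ne'
  | cast i =>
    induction j using Fin.lastCases with
    | last => rw [hl, hc]; exact sub_mem_roots (Fin.castSucc_lt_last _).ne
    | cast j => rw [hc, hc]; exact sub_mem_roots (by simpa using hij)

/-- The action of permutations of the coordinates on functions. -/
def permAct {n : ℕ} (w : Equiv.Perm (Fin n)) : (Reg (roots n) → ℝ) →ₐ[ℝ] (Reg (roots n) → ℝ) :=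
  pullback (LinearMap.funLeft ℝ ℝ w) (comp_funLeft_mem w)

lemma permAct_apply {n : ℕ} (w : Equiv.Perm (Fin n)) (f : Reg (roots n) → ℝ) (x : Reg (roots n)) :
    permAct w f x = f ⟨(x : Fin n → ℝ) ∘ w, comp_mem_Reg (comp_funLeft_mem w) x.2⟩ := rfl

lemma permAct_permAct {n : ℕ} (u w : Equiv.Perm (Fin n)) (f : Reg (roots n) → ℝ) :
    permAct u (permAct w f) = permAct (u * w) f := rfl

lemma permAct_mem_derivSpan {n : ℕ} (w : Equiv.Perm (Fin n)) {f : Reg (roots n) → ℝ}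
    (hf : f ∈ derivSpan (roots n)) : permAct w f ∈ derivSpan (roots n) := by
  induction hf using Submodule.span_induction with
  | mem f hf =>
    obtain ⟨v, h, hh, hd⟩ := hf
    have hv : LinearMap.funLeft ℝ ℝ w (v ∘ w.symm) = v := by ext i; simp
    exact HasDir.mem_derivSpan (v := v ∘ w.symm) (HasDir.pullback _ (roots_finite _)
      (roots_finite _) (by rwa [hv])) (pullback_mem _ hh)
  | zero => simp
  | add a b _ _ ha hb => rw [map_add]; exact add_mem ha hb
  | smul t a _ ha => rw [map_smul]; exact Submodule.smul_mem _ _ ha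

/-- The factors `1 / x_i` coming from `x_n = 0` are merely permuted; the sign comes from the
differences of the moving coordinates. -/
lemma permAct_vandInv {n : ℕ} (w : Equiv.Perm (Fin n)) :
    permAct w (vandInv n) = ((Equiv.Perm.sign w : ℤ) : ℝ) • vandInv n := by
  ext x
  rw [permAct_apply, Pi.smul_apply, vandInv_apply, vandInv_apply]
  have h1 := Equiv.prod_comp w fun i => ((x : Fin n → ℝ) i)⁻¹
  have h2 := Equiv.Perm.prod_Ioi_comp_eq_sign_mul_prod w
    (f := fun a b => ((x : Fin n → ℝ) a - (x : Fin n → ℝ) b)⁻¹)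
    (fun a b => by rw [← inv_neg, neg_sub])
  simp only [Function.comp_apply, smul_eq_mul]
  rw [h1, h2]
  ring

lemma permAct_xFun_zero {n : ℕ} (w : Equiv.Perm (Fin (n + 1))) :
    permAct w (xFun (n + 1) 0) = xFun (n + 1) (w 0).castSucc := by
  ext x
  simp [permAct_apply, xFun]

/-- The Morris function in the variables `x_0, …, x_r`. -/
def morris (r : ℕ) : Reg (roots (r + 1)) → ℝ :=
  xFun (r + 1) 0 ^ (r * (r + 1) / 2) * vandInv (r + 1)

/-- The function `1 / ∏ (x_i - x_{i+1})`. -/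
def pathFun (n : ℕ) : Reg (roots n) → ℝ :=
  ∏ i : Fin n, (linFun _ (coordForm n i.castSucc - coordForm n i.succ))⁻¹

/-- Extending a path by an initial step from `x_0`. -/
lemma permAct_decomposeFin_pathFun (n : ℕ) (u : Equiv.Perm (Fin (n + 1))) :
    permAct (Equiv.Perm.decomposeFin.symm (0, u)) (pathFun (n + 2)) =
      pull (n + 1) (permAct u (pathFun (n + 1))) * invFun (n + 1) (u 0).castSucc := by
  set w := Equiv.Perm.decomposeFin.symm (0, u) with hw
  have hw0 : w 0 = 0 := by simp [hw]
  have hws : ∀ i, w (Fin.succ i) = (u i).succ := fun i => by simp [hw]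
  ext x
  have ht : tailMap (n + 1) ((x : Fin (n + 2) → ℝ) ∘ w) =
      tailMap (n + 1) (x : Fin (n + 2) → ℝ) ∘ u := by
    ext i
    simp [hws]
  have h0 : coordForm (n + 1) 0 (tailMap (n + 1) (x : Fin (n + 2) → ℝ) ∘ u) =
      coordForm (n + 1) (u 0).castSucc (tailMap (n + 1) (x : Fin (n + 2) → ℝ)) := by
    simp
  rw [Pi.mul_apply, invFun_apply, pull_apply, permAct_apply, permAct_apply, ← h0, pathFun,
    Fin.prod_univ_succ, mul_comm]
  simp only [pathFun, Pi.mul_apply, Finset.prod_apply, Pi.inv_apply, linFun_apply,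
    ← Fin.succ_castSucc, LinearMap.sub_apply, coordForm_succ_apply, ht, Fin.castSucc_zero,
    coordForm_zero, Function.comp_apply, hw0]

lemma pathFun_mem (n : ℕ) : pathFun n ∈ simpleSpan (roots n) := by
  induction n with
  | zero => exact invProd_mem_simpleSpan (fun i => i.elim0) linearIndependent_empty_type
  | succ n ih =>
    have e : pathFun (n + 1) = pull n (pathFun n) * invFun n 0 := by
      rw [pathFun, Fin.prod_univ_succ, mul_comm, pathFun, map_prod]
      congr 1
      refine Finset.prod_congr rfl fun i _ => ?_
      rw [← Fin.succ_castSucc, coordForm_succ, coordForm_succ, ← LinearMap.sub_comp]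
      rfl
    rw [e]
    exact pull_mul_inv_mem_simpleSpan ih 0

lemma permAct_mem_simpleSpan {n : ℕ} (w : Equiv.Perm (Fin n)) {f : Reg (roots n) → ℝ}
    (hf : f ∈ simpleSpan (roots n)) : permAct w f ∈ simpleSpan (roots n) := by
  rw [simpleSpan_eq _ (Module.finrank_fin_fun ℝ)] at hf
  induction hf using Submodule.span_induction with
  | mem f hf =>
    obtain ⟨a, ha, hli, rfl⟩ := hf
    have e : permAct w (invProd (roots n) a) =
        invProd (roots n) fun i => a i ∘ₗ LinearMap.funLeft ℝ ℝ w := by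
      rw [invProd, map_prod]; rfl
    rw [e]
    refine invProd_mem_simpleSpan (fun i => comp_funLeft_mem w _ (ha i)) ?_
    exact hli.map' (LinearMap.funLeft ℝ ℝ w).dualMap (LinearMap.ker_eq_bot.2
      (LinearMap.dualMap_injective_of_surjective
        (LinearMap.funLeft_surjective_of_injective ℝ ℝ w w.injective)))
  | zero => simp
  | add a b _ _ ha hb => rw [map_add]; exact add_mem ha hb
  | smul t a _ ha => rw [map_smul]; exact Submodule.smul_mem _ _ ha

/-- The transpositions `swap 0 j` represent the left cosets of the stabilizer of `0`, the coset of
`u` being given by `j = u 0`. -/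
lemma sum_perm_eq {r : ℕ} {M : Type*} [AddCommMonoid M] (F : Equiv.Perm (Fin (r + 1)) → M) :
    ∑ j, ∑ w ∈ permsFixZero r, F (Equiv.swap 0 j * w) = ∑ u, F u := by
  rw [← Finset.sum_fiberwise Finset.univ (fun u : Equiv.Perm (Fin (r + 1)) => u 0)]
  refine Finset.sum_congr rfl fun j _ => ?_
  refine Finset.sum_nbij' (fun w => Equiv.swap 0 j * w) (fun u => Equiv.swap 0 j * u) ?_ ?_ ?_ ?_ ?_
  · intro w hw
    simp only [permsFixZero, Finset.mem_filter, Finset.mem_univ, true_and] at hw ⊢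
    simp [hw]
  · intro u hu
    simp only [permsFixZero, Finset.mem_filter, Finset.mem_univ, true_and] at hu ⊢
    simp [hu]
  · intro w _; simp [← mul_assoc]
  · intro w _; simp [← mul_assoc]
  · intro w _; rfl

lemma sum_permsFixZero_succ {r : ℕ} {M : Type*} [AddCommMonoid M]
    (F : Equiv.Perm (Fin (r + 2)) → M) :
    ∑ w ∈ permsFixZero (r + 1), F w =
      ∑ u : Equiv.Perm (Fin (r + 1)), F (Equiv.Perm.decomposeFin.symm (0, u)) := by
  symm
  refine Finset.sum_nbij' (fun u => Equiv.Perm.decomposeFin.symm (0, u))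
    (fun w => (Equiv.Perm.decomposeFin w).2) ?_ ?_ ?_ ?_ ?_
  · intro u _; simp [permsFixZero]
  · intro w _; simp
  · intro u _; simp
  · intro w hw
    simp only [permsFixZero, Finset.mem_filter, Finset.mem_univ, true_and] at hw
    rw [Equiv.symm_apply_eq]
    have h := Equiv.Perm.decomposeFin_symm_apply_zero (Equiv.Perm.decomposeFin w).1
      (Equiv.Perm.decomposeFin w).2
    rw [Prod.mk.eta, Equiv.symm_apply_apply, hw] at h
    exact Prod.ext h rfl
  · intro u _; rfl

/-- The alternating sum of the images of `f_Π`. -/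
def alternatingSum (r : ℕ) : Reg (roots (r + 1)) → ℝ :=
  ∑ w ∈ permsFixZero r, ((Equiv.Perm.sign w : ℤ) : ℝ) • permAct w (pathFun (r + 1))

/-- A path of rank `r + 1` starting at `x_0` is a first step to some `x_{j+1}` followed by a path of
lower rank starting there; the latter are the `swap 0 j` translates of paths starting at index `0`.
-/
lemma sum_pull_permAct_alternatingSum (r : ℕ) :
    ∑ j : Fin (r + 1), pull (r + 1) (((Equiv.Perm.sign (Equiv.swap 0 j) : ℤ) : ℝ) •
      permAct (Equiv.swap 0 j) (alternatingSum r)) * invFun (r + 1) j.castSucc =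
      alternatingSum (r + 1) := by
  rw [alternatingSum, alternatingSum, sum_permsFixZero_succ, ← sum_perm_eq]
  refine Finset.sum_congr rfl fun j _ => ?_
  rw [map_sum, Finset.smul_sum, map_sum, Finset.sum_mul]
  refine Finset.sum_congr rfl fun w hw => ?_
  have hw0 : w 0 = 0 := by simpa [permsFixZero] using hw
  have hj : (Equiv.swap 0 j * w) 0 = j := by simp [hw0]
  rw [permAct_decomposeFin_pathFun, hj, map_smul, map_smul, map_smul, permAct_permAct,
    smul_smul, smul_mul_assoc, Equiv.Perm.decomposeFin.symm_sign, if_pos rfl,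
    one_mul, Equiv.Perm.sign_mul]
  push_cast
  rfl

lemma alternatingSum_mem (r : ℕ) : alternatingSum r ∈ simpleSpan (roots (r + 1)) :=
  sum_mem fun w _ => Submodule.smul_mem _ _ (permAct_mem_simpleSpan w (pathFun_mem _))

/-- The constant in the total residue of the Morris function, a product of Catalan numbers. -/
def morrisConst (r : ℕ) : ℝ :=
  ∏ i ∈ Finset.Ico 1 r, ((2 * i).factorial : ℝ) / ((i.factorial : ℝ) * ((i + 1).factorial : ℝ))

lemma morrisConst_succ (r : ℕ) : morrisConst (r + 1) =
    ((2 * r).factorial : ℝ) / ((r.factorial : ℝ) * ((r + 1).factorial : ℝ)) * morrisConst r := by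
  cases r with
  | zero => simp [morrisConst]
  | succ r => rw [morrisConst, Finset.prod_Ico_succ_top (by omega), mul_comm]; rfl

/-- The congruence behind the formula for the total residue of the Morris function. -/
lemma morris_sub_mem (r : ℕ) :
    morris r - morrisConst r • alternatingSum r ∈ derivSpan (roots (r + 1)) := by
  induction r with
  | zero =>
    have : morris 0 - morrisConst 0 • alternatingSum 0 = 0 := by
      have hp : permsFixZero 0 = {1} := by decide
      ext x
      have hx : coordForm 1 1 (x : Fin 1 → ℝ) = 0 := coordForm_last 1 x
      simp [morris, morrisConst, alternatingSum, hp, permAct_apply, pathFun, vandInv_apply, hx]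
    rw [this]
    exact zero_mem _
  | succ r ih =>
    set p := r * (r + 1) / 2 with hp
    -- The surplus `r + 1` is exactly the power of `x_0` consumed by `aomotoFun_top`; the exponent
    -- of the Morris function of rank `r` remains.
    have hp' : (r + 1) * (r + 1 + 1) / 2 = p + (r + 1) := by
      rw [show (r + 1) * (r + 1 + 1) = r * (r + 1) + (r + 1) * 2 by ring,
        Nat.add_mul_div_right _ _ two_pos]
    have e0 : morris (r + 1) = aomotoFun (r + 1) (p + (r + 1)) 0 := by
      rw [aomotoFun_zero, morris, hp']
      rfl
    have h1 := aomotoFun_zero_sub_mem (p + (r + 1)) r r 0 rfl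
    have h2 : aomotoFun (r + 1) (p + (r + 1)) r - ∑ j : Fin (r + 1), pull (r + 1)
        (xFun (r + 1) j.castSucc ^ p * vandInv (r + 1)) * invFun (r + 1) j.castSucc ∈
        derivSpan (roots (r + 1 + 1)) := by
      rw [aomotoFun_top, ← Finset.sum_sub_distrib]
      exact sum_mem fun j _ => pull_mul_pow_mul_inv_sub_mem (vandInv_mem _) _ _
    have h3 : ∑ j : Fin (r + 1), pull (r + 1) (xFun (r + 1) j.castSucc ^ p * vandInv (r + 1)) *
        invFun (r + 1) j.castSucc - morrisConst r • alternatingSum (r + 1) ∈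
        derivSpan (roots (r + 1 + 1)) := by
      rw [← sum_pull_permAct_alternatingSum, Finset.smul_sum, ← Finset.sum_sub_distrib]
      refine sum_mem fun j _ => ?_
      have hj := Submodule.smul_mem _ ((Equiv.Perm.sign (Equiv.swap 0 j) : ℤ) : ℝ)
        (permAct_mem_derivSpan (Equiv.swap 0 j) ih)
      have hs : ((Equiv.Perm.sign (Equiv.swap 0 j) : ℤ) : ℝ) *
          ((Equiv.Perm.sign (Equiv.swap 0 j) : ℤ) : ℝ) = 1 := by
        rw [← Int.cast_mul, ← Units.val_mul, Int.units_mul_self]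
        simp
      -- The transposition turns `x_0 ^ p` into `x_j ^ p` and multiplies `vandInv` by its sign,
      -- which the scalar in `hj` cancels.
      rw [map_sub, map_smul, morris, map_mul, map_pow, permAct_xFun_zero, permAct_vandInv,
        Equiv.swap_apply_left, mul_smul_comm, smul_sub, smul_smul, hs, one_smul] at hj
      have := pull_mul_inv_mem_derivSpan hj j.castSucc
      rw [map_sub, sub_mul, smul_comm, map_smul, smul_mul_assoc] at this
      exact this
    have h4 := add_mem (add_mem h1 (Submodule.smul_mem _ (((2 * r).factorial : ℝ) /
      ((r.factorial : ℝ) * ((r + 1).factorial : ℝ))) h2)) (Submodule.smul_mem _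
      (((2 * r).factorial : ℝ) / ((r.factorial : ℝ) * ((r + 1).factorial : ℝ))) h3)
    have e1 : (r.factorial * (2 * r).factorial * (0 + 1).factorial * Nat.factorial 0 : ℝ) /
        ((r + 0).factorial * (r + 1).factorial * r.factorial) =
        ((2 * r).factorial : ℝ) / ((r.factorial : ℝ) * ((r + 1).factorial : ℝ)) := by
      simp only [zero_add, add_zero, Nat.factorial_zero, Nat.factorial_one, Nat.cast_one, mul_one]
      field_simp
    rw [e1] at h4
    rw [morrisConst_succ, mul_smul, e0]
    convert! h4 using 1
    rw [smul_sub, smul_sub]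
    abel

/-! ### Return to the definitions of the statement, `rootsA r` being `roots (r + 1)` by definition
-/

lemma morris_apply (r : ℕ) (x : Reg (roots (r + 1))) :
    morris r x = ((coordForm (r + 1) 0 - coordForm (r + 1) (Fin.last (r + 1)))
        (x : Fin (r + 1) → ℝ)) ^ (r * (r + 1) / 2) /
      ∏ i, ∏ j ∈ Finset.Ioi i, (coordForm (r + 1) i - coordForm (r + 1) j)
        (x : Fin (r + 1) → ℝ) := by
  simp [morris, vandInv, xFun, div_eq_mul_inv]

lemma morrisFun_eq (r : ℕ) : morrisFun r = morris r :=
  funext fun x => (morris_apply r x).symm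

lemma act_simpleRootFun_eq (r : ℕ) (w : Equiv.Perm (Fin (r + 1))) :
    act w (simpleRootFun r) = permAct w (pathFun (r + 1)) := by
  funext x
  change act w (simpleRootFun r) x =
    permAct w (pathFun (r + 1)) (show Reg (roots (r + 1)) from x)
  rw [permAct_apply]
  simp only [act, simpleRootFun, pathFun, one_div, Finset.prod_apply, Pi.inv_apply,
    linFun_apply, Finset.prod_inv_distrib]
  rfl

lemma totalResidue_morrisFun (r : ℕ) :
    ((totalResidue (rootsA r) ⟨morrisFun r, morrisFun_mem r⟩ : ratRing (rootsA r)) :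
      Reg (rootsA r) → ℝ) = morrisConst r •
        ∑ w ∈ permsFixZero r, ((Equiv.Perm.sign w : ℤ) : ℝ) • act w (simpleRootFun r) := by
  have h1 : ∑ w ∈ permsFixZero r, ((Equiv.Perm.sign w : ℤ) : ℝ) • act w (simpleRootFun r) =
      alternatingSum r := by
    simp only [act_simpleRootFun_eq]
    rfl
  refine totalResidue_eq (roots_finite (r + 1)) (isCompl_roots (r + 1)) _ ?_ ?_
  · rw [h1]
    exact Submodule.smul_mem _ _ (alternatingSum_mem r)
  · rw [h1, morrisFun_eq]
    exact morris_sub_mem r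

end

end TotalRes

theorem mainTheorem3 (r : ℕ) :
    IsCompl (TotalRes.simpleSpace (TotalRes.rootsA r))
        (TotalRes.derivSpace (TotalRes.rootsA r)) ∧
      ((TotalRes.totalResidue (TotalRes.rootsA r)
          ⟨TotalRes.morrisFun r, TotalRes.morrisFun_mem r⟩ :
            TotalRes.ratRing (TotalRes.rootsA r)) : TotalRes.Reg (TotalRes.rootsA r) → ℝ) =
        (∏ i ∈ Finset.Ico 1 r,
            ((2 * i).factorial : ℝ) / ((i.factorial : ℝ) * ((i + 1).factorial : ℝ))) •
          ∑ w ∈ TotalRes.permsFixZero r,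
            ((Equiv.Perm.sign w : ℤ) : ℝ) • TotalRes.act w (TotalRes.simpleRootFun r) := by
  exact ⟨TotalRes.isCompl_roots (r + 1), TotalRes.totalResidue_morrisFun r⟩
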